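/- For an integer $N>1$, the Platonic graph $\mathrm{Pl}(\mathbb{Z}/(N))$ has as vertices the pairs $(a,b)\in(\mathbb{Z}/(N))^2$ whose entries generate the unit ideal, taken up to sign; the vertices $[a,b]$ and $[c,d]$ are adjacent when $ad-bc=\pm1$. Let $N=3^{\ell}N'$ be odd, where $\ell\ge 0$ and $N'>1$ is not divisible by $3$, and let $p'$ (so $p'>3$) be the smallest prime dividing $N'$. Then $\mathrm{Pl}(\mathbb{Z}/(N))$ is regular of degree $N$. Call nontrivial the eigenvalues of its adjacency matrix, counted with multiplicity, that remain after removing one copy of the trivial eigenvalue $N$. The largest and the smallest nontrivial eigenvalues of $\mathrm{Pl}(\mathbb{Z}/(N))$ are: - $N/\sqrt{p'}$ and $-N/\sqrt{p'}$, respectively, when $\ell=0$; - $N/\sqrt{p'}$ and $-N/\min\{3,\sqrt{p'}\}$, respectively, when $\ell=1$; - $N/\min\{3,\sqrt{p'}\}$ and $-N/\min\{3,\sqrt{p'}\}$, respectively, when $\ell\geq 2$. -/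

import Mathlib

/-- The unimodular pairs over `R`: pairs whose entries generate `R` as an ideal. -/
def UnimodularPair (R : Type*) [CommRing R] : Type _ :=
  {v : R × R // Ideal.span {v.1, v.2} = ⊤}

/-- Two unimodular pairs are identified when they agree up to sign. -/
def unimodularPairSignSetoid (R : Type*) [CommRing R] : Setoid (UnimodularPair R) where
  r v w := w.1 = v.1 ∨ w.1 = -v.1
  iseqv :=
    { refl := fun _ => Or.inl rfl
      symm := by
        rintro v w (h | h)
        · exact Or.inl h.symm
        · exact Or.inr (by rw [h, neg_neg])
      trans := by
        rintro u v w (h | h) (h' | h')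
        · exact Or.inl (h'.trans h)
        · exact Or.inr (by rw [h', h])
        · exact Or.inr (by rw [h', h])
        · exact Or.inl (by rw [h', h, neg_neg]) }

/-- The vertex set of the Platonic graph: unimodular pairs up to sign. -/
def PlatonicVertex (R : Type*) [CommRing R] : Type _ :=
  Quotient (unimodularPairSignSetoid R)

/-- The Platonic graph over `R`: the classes of `(a, b)` and `(c, d)` are adjacent when
`a * d - b * c = ± 1`. (The clause `x ≠ y` is automatic when `R` is nontrivial; it only excludes
a loop over the zero ring.) -/
def platonicGraph (R : Type*) [CommRing R] : SimpleGraph (PlatonicVertex R) where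
  Adj x y := x ≠ y ∧ ∃ v w : UnimodularPair R,
    Quotient.mk (unimodularPairSignSetoid R) v = x ∧
    Quotient.mk (unimodularPairSignSetoid R) w = y ∧
    (v.1.1 * w.1.2 - v.1.2 * w.1.1 = 1 ∨ v.1.1 * w.1.2 - v.1.2 * w.1.1 = -1)
  symm := ⟨by
    rintro x y ⟨hne, v, w, hv, hw, h⟩
    refine ⟨hne.symm, w, v, hw, hv, ?_⟩
    rcases h with h | h
    · exact Or.inr (by linear_combination -h)
    · exact Or.inl (by linear_combination -h)⟩
  loopless := ⟨fun _ h => h.1 rfl⟩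

instance (R : Type*) [CommRing R] [Finite R] : Finite (UnimodularPair R) :=
  inferInstanceAs (Finite {v : R × R // Ideal.span {v.1, v.2} = ⊤})

instance (R : Type*) [CommRing R] [Finite R] : Finite (PlatonicVertex R) :=
  inferInstanceAs (Finite (Quotient (unimodularPairSignSetoid R)))

noncomputable instance (R : Type*) [CommRing R] [Finite R] : Fintype (PlatonicVertex R) :=
  Fintype.ofFinite _

noncomputable instance (R : Type*) [CommRing R] : DecidableRel (platonicGraph R).Adj :=
  Classical.decRel _

/-- `μ` is a nontrivial adjacency eigenvalue of a `d`-regular graph `G`: one of the adjacency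
eigenvalues, counted with multiplicity, that remain after one copy of the trivial eigenvalue `d`
is removed. Thus every eigenvalue other than `d` is nontrivial, and `d` itself would count as
nontrivial only if it were a multiple eigenvalue. -/
def SimpleGraph.IsNontrivialEigenvalue {V : Type*} [Fintype V] (G : SimpleGraph V)
    [DecidableRel G.Adj] (d : ℕ) (μ : ℝ) : Prop :=
  Module.End.HasEigenvalue (G.adjMatrix ℝ).mulVecLin μ ∧
    (μ = (d : ℝ) → 1 < Module.finrank ℝ (Module.End.eigenspace (G.adjMatrix ℝ).mulVecLin μ))

/-! Vertex functions are even functions `f` on pairs over `ZMod N` supported on the unimodular ones.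
In this model the adjacency operator is `lineSum`, summation over the affine line `symp v w = 1`,
and a nontrivial eigenvalue `μ` has an eigenfunction of total sum zero.

Upper bounds go by induction on `N = p * M`. If the fibre sums of `f` modulo `M` are not all zero,
they form an eigenfunction at level `M` with eigenvalue `μ / p`, and the bounds scale accordingly
(`EigenvalueBound.of_div`). Otherwise `f` sums to zero on every coset of the multiples of `M`, a
plane over the field with `p` elements. Cauchy–Schwarz along the lines of these planes gives
`‖lineSum f‖² ≤ N M ‖f‖²` (`sum_lineSum_sq_le`), hence `|μ| ≤ N / √p`.

For `p = 3` this is weaker than `N / 3`, so it is used only for `p ≥ 5`, and powers of 3 are treated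
separately. At level 3 the graph is the complete graph on four vertices, whose only nontrivial
eigenvalue is `-1`. At level `3 ^ (k + 1)` with `k ≥ 1`, the square of the operator on such `f` is
`N` minus a positive semidefinite form (`lineSum_lineSum_prime_pow`), so `μ² ≤ N ≤ (N / 3)²`. This
is why `+N / 3` enters only when `9 ∣ N`.

For sharpness, eigenfunctions at a level `d ∣ N` pull back with eigenvalue multiplied by `N / d`. An
explicit function has eigenvalue `±√d` for `d` prime, `d ≥ 5`, and for `d = 9`; level 3 supplies `-N
/ 3`. -/

/-- The standard symplectic form on `R × R`. -/
def symp {R : Type*} [CommRing R] (v w : R × R) : R := v.1 * w.2 - v.2 * w.1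

/-! ### Symplectic bases and sums over affine lines. -/

section Basic

variable {R : Type*} [CommRing R]

theorem symp_add_smul (v w u : R × R) (t : R) : symp v (w + t • u) = symp v w + t * symp v u := by
  simp [symp]; ring

theorem symp_add_smul_left (v w u : R × R) (t : R) :
    symp (w + t • u) v = symp w v + t * symp u v := by
  simp [symp]; ring

theorem symp_smul (v w : R × R) (t : R) : symp v (t • w) = t * symp v w := by
  simp [symp]; ring

theorem symp_smul_left (v w : R × R) (t : R) : symp (t • v) w = t * symp v w := by
  simp [symp]; ring

theorem symp_self (v : R × R) : symp v v = 0 := by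
  simp [symp]; ring

theorem symp_swap (v w : R × R) : symp v w = -symp w v := by
  simp [symp]; ring

theorem symp_neg (v w : R × R) : symp v (-w) = -symp v w := by
  simp [symp]; ring

theorem symp_neg_left (v w : R × R) : symp (-v) w = -symp v w := by
  simp [symp]; ring

theorem eq_of_symp_eq_one {v w : R × R} (h : symp v w = 1) (l : R × R) :
    l = symp l w • v + symp v l • w := by
  simp only [symp] at *
  ext
  · simp only [Prod.fst_add, Prod.smul_fst, smul_eq_mul]
    linear_combination (-l.1) * h
  · simp only [Prod.snd_add, Prod.smul_snd, smul_eq_mul]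
    linear_combination (-l.2) * h

/-- A pair is completable when it is the first row of a matrix of determinant one. -/
def Completable (v : R × R) : Prop := ∃ w, symp v w = 1

theorem completable_iff_span (v : R × R) :
    Completable v ↔ Ideal.span {v.1, v.2} = ⊤ := by
  rw [Ideal.eq_top_iff_one, Ideal.mem_span_pair]
  constructor
  · rintro ⟨w, h⟩
    exact ⟨w.2, -w.1, by rw [← h, symp]; ring⟩
  · rintro ⟨a, b, h⟩
    exact ⟨(-b, a), by rw [← h, symp]; ring⟩

theorem Completable.neg {v : R × R} (h : Completable v) : Completable (-v) := by
  obtain ⟨w, h⟩ := h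
  exact ⟨-w, by rw [symp_neg, symp_neg_left, neg_neg, h]⟩

theorem completable_of_symp_right {v w : R × R} (h : symp v w = 1) : Completable w :=
  ⟨-v, by rw [symp_neg, ← symp_swap, h]⟩

variable [Fintype R]

theorem sum_basis {v w : R × R} (h : symp v w = 1) (F : R × R → ℝ) :
    ∑ l, F l = ∑ a : R, ∑ b : R, F (a • v + b • w) := by
  rw [← Fintype.sum_prod_type']
  refine Finset.sum_bij' (fun l _ => (symp l w, symp v l)) (fun x _ => x.1 • v + x.2 • w)
    ?_ ?_ ?_ ?_ ?_
  · simp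
  · simp
  · intro l _
    exact (eq_of_symp_eq_one h l).symm
  · intro x _
    ext
    · simp [symp_add_smul_left, symp_smul_left, h, symp_self]
    · simp [symp_add_smul, symp_smul, h, symp_self]
  · intro l _
    exact congrArg F (eq_of_symp_eq_one h l)

variable [DecidableEq R]

/-- The sum of `f` over the affine line of all `w` with `symp v w = 1`. -/
def lineSum (f : R × R → ℝ) (v : R × R) : ℝ := ∑ w, if symp v w = 1 then f w else 0

theorem sum_line {v w₀ : R × R} (h : symp v w₀ = 1) (F : R × R → ℝ) :
    (∑ w, if symp v w = 1 then F w else 0) = ∑ t : R, F (w₀ + t • v) := by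
  rw [← Finset.sum_filter]
  refine Finset.sum_bij' (fun w _ => symp w w₀) (fun t _ => w₀ + t • v) ?_ ?_ ?_ ?_ ?_
  · simp
  · intro t _
    simp [symp_add_smul, h, symp_self]
  · intro w hw
    simp only [Finset.mem_filter, Finset.mem_univ, true_and] at hw
    conv_rhs => rw [eq_of_symp_eq_one h w, hw]
    rw [one_smul, add_comm]
  · intro t _
    simp [symp_add_smul_left, h, symp_self]
  · intro w hw
    simp only [Finset.mem_filter, Finset.mem_univ, true_and] at hw
    congr 1
    conv_lhs => rw [eq_of_symp_eq_one h w, hw]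
    rw [one_smul, add_comm]

theorem sum_line_left {v₀ w : R × R} (h : symp v₀ w = 1) (F : R × R → ℝ) :
    (∑ v, if symp v w = 1 then F v else 0) = ∑ t : R, F (v₀ + t • w) := by
  have h' : symp w (-v₀) = 1 := by rw [symp_neg, ← symp_swap, h]
  have := sum_line h' (fun u => F (-u))
  rw [← Equiv.sum_comp (Equiv.neg _)] at this
  simp only [Equiv.neg_apply, neg_neg] at this
  rw [← Equiv.sum_comp (Equiv.neg R)] at this
  simp only [Equiv.neg_apply, neg_add, neg_neg, neg_smul] at this
  rw [← this]
  refine Finset.sum_congr rfl fun x _ => ?_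
  rw [symp_neg, ← symp_swap]

theorem lineSum_eq {v w₀ : R × R} (h : symp v w₀ = 1) (f : R × R → ℝ) :
    lineSum f v = ∑ t : R, f (w₀ + t • v) := sum_line h f

theorem lineSum_of_not_completable {v : R × R} (h : ¬ Completable v) (f : R × R → ℝ) :
    lineSum f v = 0 := by
  refine Finset.sum_eq_zero fun w _ => if_neg fun hw => h ⟨w, hw⟩

theorem lineSum_eq_left {f : R × R → ℝ} (hf : ∀ v, f (-v) = f v) (w : R × R) :
    lineSum f w = ∑ v, if symp v w = 1 then f v else 0 := by
  rw [lineSum, ← Equiv.sum_comp (Equiv.neg _)]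
  refine Finset.sum_congr rfl fun x _ => ?_
  rw [Equiv.neg_apply, symp_neg, ← symp_swap, hf]

/-- The row and column sums of the incidence relation `symp v w = 1` agree. -/
theorem sum_lineSum {f : R × R → ℝ} (hf : ∀ v, ¬ Completable v → f v = 0) :
    ∑ v, lineSum f v = Fintype.card R * ∑ v, f v := by
  simp only [lineSum]
  rw [Finset.sum_comm, Finset.mul_sum]
  refine Finset.sum_congr rfl fun w _ => ?_
  by_cases hw : Completable w
  · obtain ⟨u, hu⟩ := hw
    have h : symp (-u) w = 1 := by rw [symp_neg_left, ← symp_swap, hu]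
    rw [sum_line_left h]
    simp
  · simp [hf w hw]

end Basic


/-! ### Pull-back and push-forward along reduction to a divisor. -/

section Reduction

variable {N : ℕ}

/-- Coordinatewise reduction. -/
def reducePair {d : ℕ} (hd : d ∣ N) (v : ZMod N × ZMod N) : ZMod d × ZMod d :=
  (ZMod.castHom hd (ZMod d) v.1, ZMod.castHom hd (ZMod d) v.2)

theorem symp_reducePair {d : ℕ} (hd : d ∣ N) (v w : ZMod N × ZMod N) :
    symp (reducePair hd v) (reducePair hd w) = ZMod.castHom hd (ZMod d) (symp v w) := by
  simp only [symp, reducePair, map_sub, map_mul]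

theorem Completable.reducePair {d : ℕ} (hd : d ∣ N) {v : ZMod N × ZMod N} (h : Completable v) :
    Completable (reducePair hd v) := by
  obtain ⟨w, h⟩ := h
  exact ⟨_root_.reducePair hd w, by rw [symp_reducePair, h, map_one]⟩

theorem reducePair_add_smul {d : ℕ} (hd : d ∣ N) (v w : ZMod N × ZMod N) (t : ZMod N) :
    reducePair hd (w + t • v) =
      reducePair hd w + ZMod.castHom hd (ZMod d) t • reducePair hd v := by
  ext <;> simp [reducePair, -ZMod.castHom_apply]

theorem reducePair_neg {d : ℕ} (hd : d ∣ N) (v : ZMod N × ZMod N) :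
    reducePair hd (-v) = -reducePair hd v := by
  ext <;> simp [reducePair, -ZMod.castHom_apply]

variable [NeZero N]

theorem sum_castHom {d k : ℕ} [NeZero d] (hN : N = k * d) (hd : d ∣ N) (F : ZMod d → ℝ) :
    ∑ t : ZMod N, F (ZMod.castHom hd (ZMod d) t) = k * ∑ t, F t := by
  have hs := ZMod.castHom_surjective hd
  set φ := ZMod.castHom hd (ZMod d)
  have hfib : ∀ G : ZMod d → ℝ, ∑ t : ZMod N, G (φ t) =
      (Finset.univ.filter fun t => φ t = 0).card * ∑ t, G t := by
    intro G
    rw [← Finset.sum_fiberwise (s := Finset.univ) (g := φ), Finset.mul_sum]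
    refine Finset.sum_congr rfl fun b _ => ?_
    rw [Finset.sum_congr rfl (g := fun _ => G b)
      (fun t ht => by rw [(Finset.mem_filter.1 ht).2]), Finset.sum_const, nsmul_eq_mul]
    congr 2
    exact AddMonoidHom.card_fiber_eq_of_mem_range φ.toAddMonoidHom (hs b) ⟨0, by simp⟩
  -- The constant function determines the common fibre size.
  have h1 := hfib (fun _ => 1)
  simp only [Finset.sum_const, Finset.card_univ, ZMod.card, nsmul_eq_mul, mul_one] at h1
  rw [hfib F]
  congr 1
  have hd0 : (d : ℝ) ≠ 0 := Nat.cast_ne_zero.2 (NeZero.ne d)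
  apply mul_right_cancel₀ hd0
  rw [← h1, hN]
  push_cast
  rfl

variable {p M : ℕ}

theorem natCast_mul_eq_zero_iff (hN : N = p * M) (u : ZMod N) :
    (M : ZMod N) * u = 0 ↔ ZMod.castHom (Dvd.intro _ hN.symm) (ZMod p) u = 0 := by
  have hM : 0 < M := Nat.pos_of_ne_zero fun h => NeZero.ne N (by rw [hN, h, mul_zero])
  obtain ⟨n, rfl⟩ := ZMod.natCast_zmod_surjective u
  rw [map_natCast, ZMod.natCast_eq_zero_iff, ← Nat.cast_mul, ZMod.natCast_eq_zero_iff, hN,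
    mul_comm p, Nat.mul_dvd_mul_iff_left hM]

theorem card_natCast_mul_eq_zero (hp : p.Prime) (hN : N = p * M) :
    (∑ s : ZMod N, if (M : ZMod N) * s = 0 then (1 : ℝ) else 0) = M := by
  have : NeZero p := ⟨hp.ne_zero⟩
  simp only [natCast_mul_eq_zero_iff hN]
  rw [sum_castHom (hN.trans (mul_comm _ _)) _ (fun t : ZMod p => if t = 0 then (1 : ℝ) else 0)]
  simp

/-- Multiplication by `M` sees `u` only modulo `p`, and a nonzero residue modulo `p` lifts to a unit
modulo `N`. So scaling by `u` can be undone in sums over multiples of `M`. -/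
theorem exists_unit_natCast_mul (hp : p.Prime) (hN : N = p * M) {u : ZMod N}
    (hu : (M : ZMod N) * u ≠ 0) : ∃ u' : (ZMod N)ˣ, (M : ZMod N) * u = M * u' := by
  have : Fact p.Prime := ⟨hp⟩
  have hd : p ∣ N := Dvd.intro _ hN.symm
  have h0 : ZMod.castHom hd (ZMod p) u ≠ 0 := fun h => hu ((natCast_mul_eq_zero_iff hN u).2 h)
  obtain ⟨u', h'⟩ := ZMod.unitsMap_surjective hd (Units.mk0 _ h0)
  refine ⟨u', ?_⟩
  rw [← sub_eq_zero, ← mul_sub, natCast_mul_eq_zero_iff hN, map_sub, sub_eq_zero]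
  have := congrArg Units.val h'
  simpa [ZMod.unitsMap] using this.symm

theorem sum_natCast_mul_mul (hp : p.Prime) (hN : N = p * M) {u : ZMod N}
    (hu : (M : ZMod N) * u ≠ 0) (F : ZMod N → ℝ) :
    ∑ a : ZMod N, F (M * (u * a)) = ∑ a : ZMod N, F (M * a) := by
  obtain ⟨u', h⟩ := exists_unit_natCast_mul hp hN hu
  simp only [← mul_assoc, h]
  simp only [mul_assoc]
  exact Equiv.sum_comp (Units.mulLeft u') (fun a => F (M * a))

/-- Multiplication by `M` is `M`-to-one onto the kernel of reduction modulo `M`, which has `p`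
elements. -/
theorem sum_natCast_mul (hp : p.Prime) (hN : N = p * M) (hd : M ∣ N) (F : ZMod N → ℝ) :
    ∑ s : ZMod N, F (M * s) =
      M * ∑ y : ZMod N, if ZMod.castHom hd (ZMod M) y = 0 then F y else 0 := by
  have h1 : ∀ s : ZMod N, F (M * s) = ∑ y, if M * s = y then F y else 0 := by simp
  simp only [h1]
  rw [Finset.sum_comm, Finset.mul_sum]
  refine Finset.sum_congr rfl fun y _ => ?_
  split_ifs with hy
  · have hN' : N = M * p := hN.trans (mul_comm _ _)
    obtain ⟨n, rfl⟩ := ZMod.natCast_zmod_surjective y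
    rw [map_natCast, ZMod.natCast_eq_zero_iff] at hy
    obtain ⟨m, rfl⟩ := hy
    rw [← card_natCast_mul_eq_zero hp hN, ← Equiv.sum_comp (Equiv.addRight (m : ZMod N)),
      Finset.sum_mul]
    refine Finset.sum_congr rfl fun s _ => ?_
    simp [mul_add]
  · rw [mul_zero]
    refine Finset.sum_eq_zero fun s _ => if_neg fun h => hy ?_
    rw [← h, map_mul, map_natCast, ZMod.natCast_self, zero_mul]

/-- Pulling back along reduction multiplies `lineSum` by the index. -/
theorem lineSum_comp_reducePair {d k : ℕ} [NeZero d] (hN : N = k * d) (hd : d ∣ N)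
    (g : ZMod d × ZMod d → ℝ) {v : ZMod N × ZMod N} (hv : Completable v) :
    lineSum (fun w => g (reducePair hd w)) v = k * lineSum g (reducePair hd v) := by
  obtain ⟨w, h⟩ := hv
  have h' : symp (reducePair hd v) (reducePair hd w) = 1 := by
    rw [symp_reducePair, h, map_one]
  rw [lineSum_eq h, lineSum_eq h']
  simp only [reducePair_add_smul]
  exact sum_castHom hN hd (fun t => g (reducePair hd w + t • reducePair hd v))

/-- The sum of `f` over the fibres of reduction. -/
def pushSum {d : ℕ} (hd : d ∣ N) (f : ZMod N × ZMod N → ℝ) (x : ZMod d × ZMod d) : ℝ :=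
  ∑ w, if reducePair hd w = x then f w else 0

theorem pushSum_neg {d : ℕ} (hd : d ∣ N) {f : ZMod N × ZMod N → ℝ} (hf : ∀ v, f (-v) = f v)
    (x : ZMod d × ZMod d) : pushSum hd f (-x) = pushSum hd f x := by
  rw [pushSum, ← Equiv.sum_comp (Equiv.neg _)]
  simp [reducePair_neg, hf, pushSum]

theorem pushSum_eq_zero {d : ℕ} (hd : d ∣ N) {f : ZMod N × ZMod N → ℝ}
    (hf : ∀ v, ¬ Completable v → f v = 0) {x : ZMod d × ZMod d} (hx : ¬ Completable x) :
    pushSum hd f x = 0 := by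
  refine Finset.sum_eq_zero fun w _ => ?_
  split_ifs with h
  · exact hf w fun hw => hx (h ▸ hw.reducePair hd)
  · rfl

theorem sum_pushSum {d : ℕ} [NeZero d] (hd : d ∣ N) (f : ZMod N × ZMod N → ℝ) :
    ∑ x, pushSum hd f x = ∑ v, f v := by
  simp only [pushSum]
  rw [Finset.sum_comm]
  simp

theorem sum_pushSum_mul {d : ℕ} [NeZero d] (hd : d ∣ N) (f : ZMod N × ZMod N → ℝ)
    (g : ZMod d × ZMod d → ℝ) :
    ∑ x, pushSum hd f x * g x = ∑ v, f v * g (reducePair hd v) := by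
  simp only [pushSum, Finset.sum_mul]
  rw [Finset.sum_comm]
  simp

/-- Push-forward is adjoint to pull-back and `lineSum` is symmetric on even functions, so this is
`lineSum_comp_reducePair` transposed by testing against point masses. -/
theorem lineSum_pushSum {d k : ℕ} [NeZero d] (hN : N = k * d) (hd : d ∣ N)
    {f : ZMod N × ZMod N → ℝ} (hf : ∀ v, f (-v) = f v) (hf0 : ∀ v, ¬ Completable v → f v = 0)
    (x : ZMod d × ZMod d) :
    pushSum hd (lineSum f) x = k * lineSum (pushSum hd f) x := by
  set δ : ZMod d × ZMod d → ℝ := fun y => if y = x then 1 else 0 with hδ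
  have h1 : lineSum (pushSum hd f) x = ∑ y, pushSum hd f y * lineSum δ y := by
    rw [lineSum_eq_left (pushSum_neg hd hf)]
    refine Finset.sum_congr rfl fun y _ => ?_
    have h2 : lineSum δ y = if symp y x = 1 then 1 else 0 := by
      rw [lineSum, Finset.sum_eq_single x]
      · simp [hδ]
      · intro z _ hz
        simp [hδ, hz]
      · simp
    rw [h2, mul_ite, mul_one, mul_zero]
  have h2 : pushSum hd (lineSum f) x = ∑ v, lineSum f v * δ (reducePair hd v) := by
    refine Finset.sum_congr rfl fun v _ => ?_
    simp [hδ]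
  rw [h1, h2, sum_pushSum_mul]
  simp only [lineSum_eq_left hf, Finset.sum_mul]
  rw [Finset.sum_comm, Finset.mul_sum]
  refine Finset.sum_congr rfl fun w _ => ?_
  by_cases hw : Completable w
  · have := lineSum_comp_reducePair hN hd δ hw
    rw [mul_left_comm, ← this, lineSum, Finset.mul_sum]
    refine Finset.sum_congr rfl fun v _ => ?_
    split_ifs <;> simp
  · simp [hf0 w hw]

/-- Translates vanishing of `pushSum` into vanishing of the coset sums that the norm bounds take as
hypothesis. -/
theorem sum_add_natCast_smul (hp : p.Prime) (hN : N = p * M) (hd : M ∣ N)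
    (f : ZMod N × ZMod N → ℝ) (w : ZMod N × ZMod N) :
    ∑ l, f (w + (M : ZMod N) • l) = M ^ 2 * pushSum hd f (reducePair hd w) := by
  rw [Fintype.sum_prod_type]
  have h1 : ∀ a : ZMod N, ∑ b : ZMod N, f (w + (M : ZMod N) • (a, b)) = _ := fun a =>
    sum_natCast_mul hp hN hd (fun y => f (w + ((M : ZMod N) * a, y)))
  simp only [h1, ← Finset.mul_sum]
  rw [sum_natCast_mul hp hN hd
    (fun x => ∑ y : ZMod N, if ZMod.castHom hd (ZMod M) y = 0 then f (w + (x, y)) else 0),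
    ← mul_assoc, ← sq, pushSum, ← Equiv.sum_comp (Equiv.addLeft w), Fintype.sum_prod_type]
  congr 1
  refine Finset.sum_congr rfl fun x _ => ?_
  by_cases hx : ZMod.castHom hd (ZMod M) x = 0
  · simp [reducePair, Prod.ext_iff, hx, -ZMod.castHom_apply]
  · simp [reducePair, Prod.ext_iff, hx, -ZMod.castHom_apply]

end Reduction


/-! ### The norm bound on functions with vanishing coset sums. -/

section NormBound

variable {N p M : ℕ} [NeZero N]

/-- The sum of `f` over the multiples of `M • l`, translated to `w`. -/
def shearSum (M : ℕ) (f : ZMod N × ZMod N → ℝ) (l w : ZMod N × ZMod N) : ℝ :=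
  ∑ s : ZMod N, f (w + ((M : ZMod N) * s) • l)

theorem shearSum_eq_of_smul_eq_zero {l : ZMod N × ZMod N} (hl : (M : ZMod N) • l = 0)
    (f : ZMod N × ZMod N → ℝ) (w : ZMod N × ZMod N) : shearSum M f l w = N * f w := by
  have : ∀ s : ZMod N, ((M : ZMod N) * s) • l = 0 := fun s => by
    rw [mul_comm, mul_smul, hl, smul_zero]
  simp [shearSum, this]

/-- Modulo `p` the vector `a • v + b • u` is a nonzero multiple of `v`, so both span the same line
in the coset of `w`. -/
theorem shearSum_add_smul (hp : p.Prime) (hN : N = p * M) {a b : ZMod N}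
    (ha : (M : ZMod N) * a ≠ 0) (hb : (M : ZMod N) * b = 0) (f : ZMod N × ZMod N → ℝ)
    (v u w : ZMod N × ZMod N) : shearSum M f (a • v + b • u) w = shearSum M f v w := by
  rw [shearSum, shearSum, ← sum_natCast_mul_mul hp hN ha (fun s => f (w + s • v))]
  refine Finset.sum_congr rfl fun s _ => ?_
  have : ((M : ZMod N) * s) • (a • v + b • u) =
      ((M : ZMod N) * (a * s)) • v + (s * ((M : ZMod N) * b)) • u := by
    rw [smul_add, smul_smul, smul_smul]
    congr 2 <;> ring
  rw [this, hb, mul_zero, zero_smul, add_zero]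

theorem card_mul_lineSum {v w₀ : ZMod N × ZMod N} (h : symp v w₀ = 1)
    (f : ZMod N × ZMod N → ℝ) :
    N * lineSum f v = ∑ t : ZMod N, shearSum M f v (w₀ + t • v) := by
  have h1 : ∀ s : ZMod N,
      ∑ t : ZMod N, f (w₀ + t • v + ((M : ZMod N) * s) • v) = lineSum f v := by
    intro s
    rw [lineSum_eq h, ← Equiv.sum_comp (Equiv.addRight ((M : ZMod N) * s))
      (fun t => f (w₀ + t • v))]
    simp [add_smul, add_assoc]
  simp only [shearSum]
  rw [Finset.sum_comm]
  simp [h1, ZMod.card]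

/-- Cauchy–Schwarz, applied after averaging `f` along multiples of `M • v`, which leaves its sum
over the line unchanged. -/
theorem card_mul_lineSum_sq_le (M : ℕ) (f : ZMod N × ZMod N → ℝ) (v : ZMod N × ZMod N) :
    N * lineSum f v ^ 2 ≤ ∑ w, if symp v w = 1 then shearSum M f v w ^ 2 else 0 := by
  by_cases hv : Completable v
  · obtain ⟨w₀, h⟩ := hv
    rw [sum_line h]
    have h1 := card_mul_lineSum (M := M) h f
    have h2 := sq_sum_le_card_mul_sum_sq (s := Finset.univ)
      (f := fun t : ZMod N => shearSum M f v (w₀ + t • v))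
    rw [← h1, Finset.card_univ, ZMod.card] at h2
    have hpos : (0 : ℝ) < N := Nat.cast_pos.2 (NeZero.pos N)
    refine le_of_mul_le_mul_left ?_ hpos
    calc (N : ℝ) * (N * lineSum f v ^ 2) = (N * lineSum f v) ^ 2 := by ring
      _ ≤ _ := h2
  · rw [lineSum_of_not_completable hv]
    simp only [ne_eq, OfNat.ofNat_ne_zero, not_false_eq_true, zero_pow, mul_zero]
    exact Finset.sum_nonneg fun w _ => by positivity

theorem card_natCast_mul_ne_zero (hp : p.Prime) (hN : N = p * M) :
    (∑ s : ZMod N, if (M : ZMod N) * s ≠ 0 then (1 : ℝ) else 0) = N - M := by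
  have h1 : (∑ s : ZMod N, if (M : ZMod N) * s ≠ 0 then (1 : ℝ) else 0) =
      ∑ s : ZMod N, (1 - if (M : ZMod N) * s = 0 then (1 : ℝ) else 0) :=
    Finset.sum_congr rfl fun s _ => by split_ifs <;> simp_all
  rw [h1, Finset.sum_sub_distrib, card_natCast_mul_eq_zero hp hN]
  simp [ZMod.card]

/-- The `l` on the right reduce modulo `p` to nonzero multiples of `v`. There are `(N - M) * M` of
them, all with the same shear sum as `v`; replacing `v` by them frees the direction from the line
through `w`. -/
theorem shearSum_sq_le (hp : p.Prime) (hN : N = p * M) {v w₀ : ZMod N × ZMod N}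
    (h : symp v w₀ = 1) (f : ZMod N × ZMod N → ℝ) (w : ZMod N × ZMod N) :
    (N - M) * M * shearSum M f v w ^ 2 ≤
      ∑ l, if (M : ZMod N) • l ≠ 0 ∧ (M : ZMod N) * symp l v = 0 then
        shearSum M f l w ^ 2 else 0 := by
  rw [sum_basis h, ← card_natCast_mul_ne_zero hp hN, ← card_natCast_mul_eq_zero hp hN,
    Finset.sum_mul_sum, Finset.sum_mul]
  refine Finset.sum_le_sum fun a _ => ?_
  rw [Finset.sum_mul]
  refine Finset.sum_le_sum fun b _ => ?_
  by_cases ha : (M : ZMod N) * a = 0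
  · simp only [ha, ne_eq, not_true_eq_false, if_false, zero_mul]
    positivity
  by_cases hb : (M : ZMod N) * b = 0
  · rw [shearSum_add_smul hp hN ha hb, if_pos ha, if_pos hb, if_pos]
    · simp
    · constructor
      · intro h0
        apply ha
        have h1 := congrArg (fun l => symp l w₀) h0
        simp only [symp_smul_left, symp_add_smul_left, symp_self, h, mul_one, mul_zero,
          add_zero] at h1
        rw [h1]
        simp [symp]
      · rw [symp_add_smul_left, symp_smul_left, symp_self, symp_swap w₀ v, h]
        linear_combination -hb
  · simp only [hb, if_false, mul_zero, zero_mul]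
    positivity

/-- Along the line the condition is affine in `t` modulo `p`. Two solutions that differ modulo `p`
would make `l` orthogonal to a symplectic basis modulo `p`, forcing `M • l = 0`; so at most one
residue class, of size `M`, occurs. -/
theorem card_line_le (hp : p.Prime) (hN : N = p * M) {w l : ZMod N × ZMod N}
    (hw : Completable w) (hl : (M : ZMod N) • l ≠ 0) :
    (∑ v, if symp v w = 1 then (if (M : ZMod N) * symp l v = 0 then (1 : ℝ) else 0) else 0)
      ≤ M := by
  obtain ⟨u, hu⟩ := hw
  have h : symp (-u) w = 1 := by rw [symp_neg_left, ← symp_swap, hu]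
  rw [sum_line_left h]
  by_cases hex : ∃ t : ZMod N, (M : ZMod N) * symp l (-u + t • w) = 0
  · obtain ⟨t₁, h₁⟩ := hex
    rw [← card_natCast_mul_eq_zero hp hN, ← Equiv.sum_comp (Equiv.subRight t₁)
      (fun t => if (M : ZMod N) * t = 0 then (1 : ℝ) else 0)]
    refine Finset.sum_le_sum fun t _ => ?_
    by_cases h₂ : (M : ZMod N) * symp l (-u + t • w) = 0
    · rw [if_pos h₂, if_pos]
      by_contra h₃
      obtain ⟨c, hc⟩ := exists_unit_natCast_mul hp hN h₃
      rw [symp_add_smul] at h₁ h₂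
      have h₄ : (M : ZMod N) * symp l w = 0 := by
        have : (c : ZMod N) * ((M : ZMod N) * symp l w) = 0 := by
          rw [Equiv.subRight_apply] at hc
          linear_combination h₂ - h₁ - symp l w * hc
        simpa using this
      have h₅ : (M : ZMod N) * symp l (-u) = 0 := by
        linear_combination h₁ - t₁ * h₄
      apply hl
      rw [eq_of_symp_eq_one h l, smul_add, smul_smul, smul_smul, h₄, symp_swap, mul_neg, h₅]
      simp
    · rw [if_neg h₂]
      positivity
  · push Not at hex
    simp [hex]

/-- Expanding the square leaves correlations of `f` at shift `M • (s • l)`. Summing over `l`, the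
coset hypothesis kills every `s` with `M * s ≠ 0`, and `M` values of `s` survive. -/
theorem sum_shearSum_sq (hp : p.Prime) (hN : N = p * M) {f : ZMod N × ZMod N → ℝ}
    (hf : ∀ w, ∑ l, f (w + (M : ZMod N) • l) = 0) :
    ∑ w, ∑ l, shearSum M f l w ^ 2 = N ^ 3 * M * ∑ w, f w ^ 2 := by
  have h1 : ∀ l, ∑ w, shearSum M f l w ^ 2 =
      N * ∑ w, ∑ s : ZMod N, f w * f (w + (M : ZMod N) • (s • l)) := by
    intro l
    simp only [sq, shearSum, Finset.sum_mul_sum]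
    rw [Finset.sum_comm]
    have h2 : ∀ s : ZMod N,
        ∑ w, ∑ s' : ZMod N, f (w + ((M : ZMod N) * s) • l) * f (w + ((M : ZMod N) * s') • l) =
        ∑ w, ∑ s' : ZMod N, f w * f (w + (M : ZMod N) • (s' • l)) := by
      intro s
      rw [← Equiv.sum_comp (Equiv.subRight (((M : ZMod N) * s) • l))]
      refine Finset.sum_congr rfl fun w _ => ?_
      rw [← Equiv.sum_comp (Equiv.addRight s)]
      refine Finset.sum_congr rfl fun s' _ => ?_
      simp only [Equiv.subRight_apply, Equiv.coe_addRight, sub_add_cancel]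
      congr 2
      rw [mul_add, add_smul, mul_smul _ s']
      abel
    simp [h2, ZMod.card]
  have h3 : ∀ w, ∀ s : ZMod N, ∑ l, f (w + (M : ZMod N) • (s • l)) =
      if (M : ZMod N) * s = 0 then (N : ℝ) ^ 2 * f w else 0 := by
    intro w s
    simp only [smul_smul]
    split_ifs with hs
    · simp [hs, ZMod.card, sq]
    · obtain ⟨u, hu⟩ := exists_unit_natCast_mul hp hN hs
      rw [hu, ← hf w,
        ← Equiv.sum_comp (MulAction.toPerm u) (fun l => f (w + (M : ZMod N) • l))]
      refine Finset.sum_congr rfl fun l _ => ?_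
      rw [MulAction.toPerm_apply, Units.smul_def, mul_smul]
  rw [Finset.sum_comm]
  simp only [h1]
  rw [← Finset.mul_sum, Finset.sum_comm]
  have h4 : ∀ w, ∑ l, ∑ s : ZMod N, f w * f (w + (M : ZMod N) • (s • l)) =
      M * (N : ℝ) ^ 2 * f w ^ 2 := by
    intro w
    rw [Finset.sum_comm]
    simp only [← Finset.mul_sum, h3]
    rw [← card_natCast_mul_eq_zero hp hN, Finset.sum_mul, Finset.sum_mul, Finset.mul_sum]
    refine Finset.sum_congr rfl fun s _ => ?_
    split_ifs <;> ring
  simp only [h4]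
  rw [← Finset.mul_sum]
  ring

theorem sum_shearSum_sq_ne_zero (hp : p.Prime) (hN : N = p * M) {f : ZMod N × ZMod N → ℝ}
    (hf : ∀ w, ∑ l, f (w + (M : ZMod N) • l) = 0) :
    ∑ w, ∑ l, (if (M : ZMod N) • l ≠ 0 then shearSum M f l w ^ 2 else 0) =
      N ^ 2 * M * (N - M) * ∑ w, f w ^ 2 := by
  have h1 : ∀ w l, (if (M : ZMod N) • l ≠ 0 then shearSum M f l w ^ 2 else 0) =
      shearSum M f l w ^ 2 - (if (M : ZMod N) • l = 0 then 1 else 0) * ((N : ℝ) * f w) ^ 2 := by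
    intro w l
    by_cases hl : (M : ZMod N) • l = 0
    · simp [hl, shearSum_eq_of_smul_eq_zero hl]
    · simp [hl]
  have h2 : (∑ l : ZMod N × ZMod N, if (M : ZMod N) • l = 0 then (1 : ℝ) else 0) = M * M := by
    nth_rw 1 [← card_natCast_mul_eq_zero hp hN]
    rw [← card_natCast_mul_eq_zero hp hN, Finset.sum_mul_sum, Fintype.sum_prod_type]
    refine Finset.sum_congr rfl fun a _ => Finset.sum_congr rfl fun b _ => ?_
    by_cases ha : (M : ZMod N) * a = 0 <;> simp [Prod.ext_iff, ha]
  simp only [h1, Finset.sum_sub_distrib, ← Finset.sum_mul, h2]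
  rw [sum_shearSum_sq hp hN hf, ← Finset.mul_sum]
  simp only [mul_pow, ← Finset.mul_sum]
  ring

/-- A function all of whose sums over cosets of the kernel of reduction modulo `M` vanish
satisfies the norm bound `‖lineSum f‖² ≤ N M ‖f‖²`. -/
theorem sum_lineSum_sq_le (hp : p.Prime) (hN : N = p * M) {f : ZMod N × ZMod N → ℝ}
    (hf : ∀ w, ∑ l, f (w + (M : ZMod N) • l) = 0) :
    ∑ v, lineSum f v ^ 2 ≤ N * M * ∑ v, f v ^ 2 := by
  have hM : 0 < M := Nat.pos_of_ne_zero fun h => NeZero.ne N (by rw [hN, h, mul_zero])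
  have hMN : M < N := by
    rw [hN]
    exact lt_mul_of_one_lt_left hM hp.one_lt
  have hM' : (0 : ℝ) < M := Nat.cast_pos.2 hM
  have hN' : (0 : ℝ) < N := hM'.trans (Nat.cast_lt.2 hMN)
  have hd : (0 : ℝ) < N - M := sub_pos.2 (Nat.cast_lt.2 hMN)
  set B : (ZMod N × ZMod N) → (ZMod N × ZMod N) → ℝ := fun l w => shearSum M f l w ^ 2 with hB
  have key : (N - M) * M * (N * ∑ v, lineSum f v ^ 2) ≤
      M * (N ^ 2 * M * (N - M) * ∑ w, f w ^ 2) := by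
    calc (N - M) * M * (N * ∑ v, lineSum f v ^ 2)
        ≤ (N - M) * M * ∑ v, ∑ w, (if symp v w = 1 then B v w else 0) := by
          rw [Finset.mul_sum]
          gcongr with v
          exact card_mul_lineSum_sq_le M f v
      _ = ∑ v, ∑ w, (if symp v w = 1 then (N - M) * M * B v w else 0) := by
          simp only [Finset.mul_sum, mul_ite, mul_zero]
      _ ≤ ∑ v, ∑ w, (if symp v w = 1 then (∑ l, if (M : ZMod N) • l ≠ 0 ∧
            (M : ZMod N) * symp l v = 0 then B l w else 0) else 0) := by
          gcongr with v _ w _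
          split_ifs with h
          · exact shearSum_sq_le hp hN h f w
          · exact le_rfl
      -- With the order of summation exchanged, `v` enters only through a count, bounded by `M`
      -- through `card_line_le`.
      _ = ∑ w, ∑ l, (if (M : ZMod N) • l ≠ 0 then B l w else 0) *
            ∑ v, (if symp v w = 1 then
              (if (M : ZMod N) * symp l v = 0 then (1 : ℝ) else 0) else 0) := by
          rw [Finset.sum_comm]
          refine Finset.sum_congr rfl fun w _ => ?_
          simp only [Finset.mul_sum]
          rw [Finset.sum_comm]
          refine Finset.sum_congr rfl fun v _ => ?_
          split_ifs with h
          · refine Finset.sum_congr rfl fun l _ => ?_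
            by_cases h1 : (M : ZMod N) • l = 0 <;>
              by_cases h2 : (M : ZMod N) * symp l v = 0 <;> simp [h1, h2]
          · simp
      _ ≤ ∑ w, ∑ l, (if (M : ZMod N) • l ≠ 0 then B l w else 0) * (M : ℝ) := by
          refine Finset.sum_le_sum fun w _ => Finset.sum_le_sum fun l _ => ?_
          by_cases hl : (M : ZMod N) • l = 0
          · simp [hl]
          rw [if_pos hl]
          have hB0 : 0 ≤ B l w := sq_nonneg _
          refine mul_le_mul_of_nonneg_left ?_ hB0
          by_cases hw : Completable w
          · exact card_line_le hp hN hw hl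
          · rw [Finset.sum_eq_zero]
            · positivity
            · exact fun v _ => if_neg fun h => hw (completable_of_symp_right h)
      _ = M * (N ^ 2 * M * (N - M) * ∑ w, f w ^ 2) := by
          simp only [← Finset.sum_mul]
          rw [sum_shearSum_sq_ne_zero hp hN hf, mul_comm]
  have hc : 0 < ((N : ℝ) - M) * M * N := by positivity
  refine le_of_mul_le_mul_left ?_ hc
  calc _ = (N - M) * M * (N * ∑ v, lineSum f v ^ 2) := by ring
    _ ≤ _ := key
    _ = _ := by ring

end NormBound


/-! ### The squared operator at prime power level. -/

section PrimePower

variable {N p M : ℕ} [NeZero N]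

omit [NeZero N] in
theorem exists_nilpotent_mul_eq {k : ℕ} (hp : p.Prime) (hk : N = p ^ (k + 1)) {t : ZMod N}
    (ht : (p : ZMod N) * t ≠ 0) :
    ∃ r : ZMod N, IsNilpotent r ∧ r * t = ((p ^ k : ℕ) : ZMod N) := by
  have : NeZero N := ⟨by rw [hk]; exact pow_ne_zero _ hp.ne_zero⟩
  obtain ⟨n, rfl⟩ := ZMod.natCast_zmod_surjective t
  have hn : ¬ p ^ k ∣ n := by
    intro h
    apply ht
    rw [← Nat.cast_mul, ZMod.natCast_eq_zero_iff, hk, pow_succ']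
    exact mul_dvd_mul_left p h
  have hdvd : n.gcd N ∣ p ^ (k + 1) := by
    rw [← hk]
    exact Nat.gcd_dvd_right n N
  obtain ⟨j, hj, hg⟩ := (Nat.dvd_prime_pow hp).1 hdvd
  have hjk : j < k := by
    by_contra! h
    exact hn ((pow_dvd_pow p h).trans (hg ▸ Nat.gcd_dvd_left n N))
  have hb : (n : ZMod N) * (Nat.gcdA n N : ZMod N) = (p : ZMod N) ^ j := by
    have := congrArg (Int.cast : ℤ → ZMod N) (Nat.gcd_eq_gcd_ab n N)
    rw [hg] at this
    push_cast at this
    rw [this]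
    simp
  -- Bézout gives `n * gcdA = p ^ j` with `j < k`; the missing factor `p ^ (k - j)` has positive
  -- exponent, which makes the witness nilpotent.
  refine ⟨Nat.gcdA n N * (p : ZMod N) ^ (k - j), ⟨k + 1, ?_⟩, ?_⟩
  · have h0 : (p : ZMod N) ^ (k + 1) = 0 := by
      rw [← Nat.cast_pow, ← hk, ZMod.natCast_self]
    rw [mul_pow, ← pow_mul, mul_comm (k - j), pow_mul, h0, zero_pow (by omega), mul_zero]
  · rw [mul_right_comm, mul_comm _ (n : ZMod N), hb, ← pow_add, Nat.add_sub_cancel' hjk.le]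
    push_cast
    rfl

/-- The sum of `f (v + t • w)` over all `w` with `symp v w = 1`. -/
def transvectionSum (f : ZMod N × ZMod N → ℝ) (v : ZMod N × ZMod N) (t : ZMod N) : ℝ :=
  ∑ w, if symp v w = 1 then f (v + t • w) else 0

theorem lineSum_lineSum {f : ZMod N × ZMod N → ℝ} (hf : ∀ v, f (-v) = f v)
    (v : ZMod N × ZMod N) : lineSum (lineSum f) v = ∑ t, transvectionSum f v t := by
  simp only [transvectionSum]
  rw [Finset.sum_comm, lineSum]
  refine Finset.sum_congr rfl fun w _ => ?_
  split_ifs with h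
  · have h' : symp w (-v) = 1 := by rw [symp_neg, ← symp_swap, h]
    rw [lineSum_eq h', ← Equiv.sum_comp (Equiv.neg (ZMod N))]
    refine Finset.sum_congr rfl fun t _ => ?_
    rw [← hf, Equiv.neg_apply, neg_add, neg_neg, neg_smul, neg_neg]
  · simp

/-- The substitution `w ↦ (1 + r * symp v x)⁻¹ • (w + r • x)` preserves the line `symp v w = 1`. It
turns a shift of `t` by `m * symp v x` into a translation of the argument by `m • x`, over which `f`
can then be averaged. -/
theorem transvectionSum_add {r t : ZMod N} {m : ZMod N} (hr : IsNilpotent r) (hrt : r * t = m)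
    (f : ZMod N × ZMod N → ℝ) (v x : ZMod N × ZMod N) :
    transvectionSum f v (t + m * symp v x) =
      ∑ w, if symp v w = 1 then f (v + t • w + m • x) else 0 := by
  obtain ⟨u, hu⟩ := ((Commute.all r (symp v x)).isNilpotent_mul_right hr).isUnit_one_add
  rw [transvectionSum, ← Equiv.sum_comp
    ((Equiv.addRight (r • x)).trans (MulAction.toPerm u⁻¹))]
  refine Finset.sum_congr rfl fun w _ => ?_
  have h1 : ((Equiv.addRight (r • x)).trans (MulAction.toPerm u⁻¹)) w =
      ((u⁻¹ : (ZMod N)ˣ) : ZMod N) • (w + r • x) := rfl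
  have h2 : t + m * symp v x = t * u := by rw [hu, ← hrt]; ring
  rw [h1, h2, smul_smul, mul_assoc, Units.mul_inv, mul_one, symp_smul, symp_add_smul, smul_add t,
    smul_smul t, mul_comm t r, hrt, ← add_assoc]
  refine if_congr ?_ rfl rfl
  rw [Units.inv_mul_eq_iff_eq_mul, mul_one, hu, add_left_inj]

theorem sum_transvectionSum_add {r t : ZMod N} (hr : IsNilpotent r) (hrt : r * t = M)
    {f : ZMod N × ZMod N → ℝ} (hf : ∀ w, ∑ l, f (w + (M : ZMod N) • l) = 0)
    {v : ZMod N × ZMod N} (hv : Completable v) :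
    ∑ d : ZMod N, transvectionSum f v (t + M * d) = 0 := by
  obtain ⟨w₀, h⟩ := hv
  have h1 : ∑ x, transvectionSum f v (t + M * symp v x) = 0 := by
    simp only [transvectionSum_add hr hrt]
    rw [Finset.sum_comm]
    refine Finset.sum_eq_zero fun w _ => ?_
    split_ifs
    · exact hf _
    · simp
  rw [sum_basis h] at h1
  simp only [symp_add_smul, symp_smul, symp_self, h, mul_zero, zero_add, mul_one] at h1
  simpa [ZMod.card, NeZero.ne N] using h1

/-- Shifting `t` by multiples of `p ^ k` preserves `p * t ≠ 0`, so the sum may be averaged over such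
shifts, and each term then averages to zero. -/
theorem sum_transvectionSum_ne_zero {k : ℕ} (hp : p.Prime) (hk : N = p ^ (k + 1))
    {f : ZMod N × ZMod N → ℝ} (hf : ∀ w, ∑ l, f (w + ((p ^ k : ℕ) : ZMod N) • l) = 0)
    {v : ZMod N × ZMod N} (hv : Completable v) :
    (∑ t : ZMod N, if (p : ZMod N) * t ≠ 0 then transvectionSum f v t else 0) = 0 := by
  have hpM : (p : ZMod N) * ((p ^ k : ℕ) : ZMod N) = 0 := by
    rw [← Nat.cast_mul, ← pow_succ', ← hk, ZMod.natCast_self]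
  have h1 : ∀ d : ZMod N,
      (∑ t : ZMod N, if (p : ZMod N) * t ≠ 0 then transvectionSum f v t else 0) =
      ∑ t : ZMod N, if (p : ZMod N) * t ≠ 0 then
        transvectionSum f v (t + ((p ^ k : ℕ) : ZMod N) * d) else 0 := by
    intro d
    rw [← Equiv.sum_comp (Equiv.addRight (((p ^ k : ℕ) : ZMod N) * d))]
    simp only [Equiv.coe_addRight, mul_add, ← mul_assoc, hpM, zero_mul, add_zero]
  have h2 : ∑ d : ZMod N, (∑ t : ZMod N, if (p : ZMod N) * t ≠ 0 then
      transvectionSum f v (t + ((p ^ k : ℕ) : ZMod N) * d) else 0) = 0 := by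
    rw [Finset.sum_comm]
    refine Finset.sum_eq_zero fun t _ => ?_
    split_ifs with ht
    · obtain ⟨r, hr, hrt⟩ := exists_nilpotent_mul_eq hp hk ht
      exact sum_transvectionSum_add hr hrt hf hv
    · simp
  simp only [← h1] at h2
  simpa [ZMod.card, NeZero.ne N] using h2

/-- For `M * τ ≠ 0` the transvection sum equals the line sum `H τ`, and all the `H τ` add up to a
multiple-counted coset sum, hence to zero. Only the discrepancy at the `M` values with `M * τ = 0`
remains. -/
theorem sum_transvectionSum_natCast_mul (hp : p.Prime) (hN : N = p * M)
    {f : ZMod N × ZMod N → ℝ} (hf : ∀ w, ∑ l, f (w + (M : ZMod N) • l) = 0)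
    {v : ZMod N × ZMod N} (hv : Completable v) :
    ∑ τ : ZMod N, transvectionSum f v (M * τ) = M * (N * f v - shearSum M f v v) := by
  obtain ⟨w₀, h⟩ := hv
  set H : ZMod N → ℝ := fun τ =>
    ∑ s : ZMod N, f (v + ((M : ZMod N) * τ) • w₀ + ((M : ZMod N) * s) • v) with hH
  have h1 : ∑ τ, H τ = 0 := by
    rw [← hf v, sum_basis h, Finset.sum_comm]
    simp only [smul_add, smul_smul, add_assoc]
    refine Finset.sum_congr rfl fun τ _ => Finset.sum_congr rfl fun s _ => ?_
    rw [add_comm (((M : ZMod N) * τ) • _)]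
  have h2 : ∀ τ : ZMod N, transvectionSum f v (M * τ) = H τ +
      (if (M : ZMod N) * τ = 0 then (1 : ℝ) else 0) * (N * f v - shearSum M f v v) := by
    intro τ
    rw [transvectionSum, sum_line h]
    by_cases hτ : (M : ZMod N) * τ = 0
    · simp [hτ, hH, shearSum, ZMod.card]
    · rw [if_neg hτ, zero_mul, add_zero, hH]
      simp only
      rw [← sum_natCast_mul_mul hp hN hτ
        (fun s => f (v + ((M : ZMod N) * τ) • w₀ + s • v))]
      refine Finset.sum_congr rfl fun s _ => ?_
      rw [smul_add, smul_smul, ← add_assoc, mul_assoc]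
  simp only [h2, Finset.sum_add_distrib, h1, zero_add, ← Finset.sum_mul,
    card_natCast_mul_eq_zero hp hN]

theorem lineSum_lineSum_prime_pow {k : ℕ} (hp : p.Prime) (hk : N = p ^ (k + 1))
    {f : ZMod N × ZMod N → ℝ} (heven : ∀ v, f (-v) = f v)
    (hf : ∀ w, ∑ l, f (w + ((p ^ k : ℕ) : ZMod N) • l) = 0)
    {v : ZMod N × ZMod N} (hv : Completable v) :
    lineSum (lineSum f) v = N * f v - shearSum (p ^ k) f v v := by
  have hN : N = p * p ^ k := hk.trans (pow_succ' p k)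
  have hM : ((p ^ k : ℕ) : ℝ) ≠ 0 := Nat.cast_ne_zero.2 (pow_ne_zero _ hp.ne_zero)
  have h1 := sum_transvectionSum_natCast_mul hp hN hf hv
  rw [sum_natCast_mul hp hN (Dvd.intro_left _ hN.symm)] at h1
  simp only [← natCast_mul_eq_zero_iff (hN.trans (mul_comm _ _))] at h1
  have h2 := sum_transvectionSum_ne_zero hp hk hf hv
  have h3 : ∀ t : ZMod N, transvectionSum f v t =
      (if (p : ZMod N) * t = 0 then transvectionSum f v t else 0) +
      if (p : ZMod N) * t ≠ 0 then transvectionSum f v t else 0 := fun t => by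
    by_cases ht : (p : ZMod N) * t = 0 <;> simp [ht]
  rw [lineSum_lineSum heven, Finset.sum_congr rfl fun t _ => h3 t, Finset.sum_add_distrib, h2,
    add_zero, mul_left_cancel₀ hM h1]

/-- Since `M * M = 0`, the scalars `1 + M * s` multiply as the `s` add. Thus `shearSum M f v v` sums
`f` over an action of `ZMod N` by permutations, which is `N` times an orthogonal projection. -/
theorem sum_mul_shearSum_self_nonneg (hM : (M : ZMod N) * M = 0) (f : ZMod N × ZMod N → ℝ) :
    0 ≤ ∑ v, f v * shearSum M f v v := by
  have h1 : ∀ s : ZMod N, ∑ v, f v * shearSum M f v v =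
      ∑ v, f (v + ((M : ZMod N) * s) • v) * shearSum M f v v := by
    intro s
    have hnil : IsNilpotent ((M : ZMod N) * s) := ⟨2, by linear_combination s ^ 2 * hM⟩
    obtain ⟨u, hu⟩ := hnil.isUnit_one_add
    rw [← Equiv.sum_comp (MulAction.toPerm u)]
    refine Finset.sum_congr rfl fun v _ => ?_
    have h2 : MulAction.toPerm u v = v + ((M : ZMod N) * s) • v := by
      rw [MulAction.toPerm_apply, Units.smul_def, hu, add_smul, one_smul]
    rw [h2]
    congr 1
    rw [shearSum, shearSum, ← Equiv.sum_comp (Equiv.addRight s)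
      (fun a => f (v + ((M : ZMod N) * a) • v))]
    refine Finset.sum_congr rfl fun a _ => ?_
    congr 1
    rw [Equiv.coe_addRight, smul_add, smul_smul, add_assoc, ← add_smul, ← add_smul]
    congr 2
    linear_combination a * s * hM
  have h2 : (N : ℝ) * ∑ v, f v * shearSum M f v v = ∑ v, shearSum M f v v ^ 2 := by
    have h3 : ∑ s : ZMod N, ∑ v, f (v + ((M : ZMod N) * s) • v) * shearSum M f v v =
        ∑ v, shearSum M f v v ^ 2 := by
      rw [Finset.sum_comm]
      refine Finset.sum_congr rfl fun v _ => ?_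
      rw [← Finset.sum_mul, sq]
      rfl
    rw [← h3]
    simp only [← h1]
    simp [ZMod.card]
  have hpos : (0 : ℝ) < N := Nat.cast_pos.2 (NeZero.pos N)
  refine le_of_mul_le_mul_left ?_ hpos
  rw [h2, mul_zero]
  positivity

theorem sum_sq_pos {ι : Type*} [Fintype ι] {f : ι → ℝ} (hf : f ≠ 0) : 0 < ∑ v, f v ^ 2 := by
  obtain ⟨v, hv⟩ := Function.ne_iff.1 hf
  have hv' : f v ≠ 0 := hv
  exact Finset.sum_pos' (fun _ _ => sq_nonneg _) ⟨v, Finset.mem_univ _, by positivity⟩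

theorem eigenvalue_sq_le_prime_pow {k : ℕ} (hp : p.Prime) (hk : N = p ^ (k + 1)) (hk1 : 1 ≤ k)
    {f : ZMod N × ZMod N → ℝ} (heven : ∀ v, f (-v) = f v) (hne : f ≠ 0)
    (hf0 : ∀ v, ¬ Completable v → f v = 0)
    (hf : ∀ w, ∑ l, f (w + ((p ^ k : ℕ) : ZMod N) • l) = 0) {μ : ℝ}
    (hμ : ∀ v, lineSum f v = μ * f v) : μ ^ 2 ≤ N := by
  -- Here `k ≥ 1` is essential: it gives `k + 1 ≤ 2 * k`.
  have hM : ((p ^ k : ℕ) : ZMod N) * ((p ^ k : ℕ) : ZMod N) = 0 := by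
    rw [← Nat.cast_mul, ZMod.natCast_eq_zero_iff, hk, ← pow_add]
    exact pow_dvd_pow p (by omega)
  have h0 := sum_mul_shearSum_self_nonneg hM f
  have h1 : ∀ v, μ ^ 2 * f v ^ 2 = N * f v ^ 2 - f v * shearSum (p ^ k) f v v := by
    intro v
    by_cases hv : Completable v
    · have h2 := lineSum_lineSum_prime_pow hp hk heven hf hv
      have h3 : lineSum (lineSum f) v = μ * (μ * f v) := by
        rw [← hμ v, lineSum, lineSum, Finset.mul_sum]
        refine Finset.sum_congr rfl fun w _ => ?_
        rw [hμ w]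
        simp
      rw [h3] at h2
      linear_combination f v * h2
    · simp [hf0 v hv]
  have h4 : μ ^ 2 * ∑ v, f v ^ 2 = N * ∑ v, f v ^ 2 - ∑ v, f v * shearSum (p ^ k) f v v := by
    simp only [Finset.mul_sum, h1, Finset.sum_sub_distrib]
  refine le_of_mul_le_mul_right ?_ (sum_sq_pos hne)
  linarith

end PrimePower


/-! ### Upper bounds by descent on the level. -/

section Spectrum

/-- Up to sign there are four nonzero pairs, `v`, `w`, `v + w` and `v - w`. The line meets all of
them but `v`, and the four values sum to zero. -/
theorem lineSum_three {f : ZMod 3 × ZMod 3 → ℝ} (heven : ∀ v, f (-v) = f v)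
    (hf0 : ∀ v, ¬ Completable v → f v = 0) (hsum : ∑ v, f v = 0) {v : ZMod 3 × ZMod 3}
    (hv : Completable v) : lineSum f v = -f v := by
  obtain ⟨w, h⟩ := hv
  have hu : ∀ F : ZMod 3 → ℝ, ∑ t, F t = F 0 + F 1 + F (-1) := fun F => Fin.sum_univ_three F
  have h0 : f 0 = 0 := hf0 0 fun ⟨u, hu⟩ => by simp [symp] at hu
  rw [sum_basis h] at hsum
  simp only [hu, zero_smul, one_smul, neg_smul, zero_add, add_zero, h0, heven] at hsum
  have h1 := heven (v + w)
  have h2 := heven (-v + w)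
  rw [neg_add] at h1 h2
  rw [neg_neg] at h2
  rw [lineSum_eq h]
  simp only [hu, zero_smul, one_smul, neg_smul, add_zero]
  rw [h1, h2] at hsum
  rw [add_comm w v, add_comm w (-v)]
  linarith

variable {N p M : ℕ} [NeZero N]

theorem abs_eigenvalue_le (hp : p.Prime) (hN : N = p * M) {f : ZMod N × ZMod N → ℝ}
    (hne : f ≠ 0) (hf : ∀ w, ∑ l, f (w + (M : ZMod N) • l) = 0) {μ : ℝ}
    (hμ : ∀ v, lineSum f v = μ * f v) : |μ| ≤ N / √p := by
  have hp0 : (0 : ℝ) < p := Nat.cast_pos.2 hp.pos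
  have h1 := sum_lineSum_sq_le hp hN hf
  simp only [hμ, mul_pow, ← Finset.mul_sum] at h1
  have h2 := le_of_mul_le_mul_right h1 (sum_sq_pos hne)
  refine abs_le_of_sq_le_sq ?_ (by positivity)
  rw [div_pow, Real.sq_sqrt hp0.le, le_div_iff₀ hp0]
  calc μ ^ 2 * p ≤ N * M * p := by gcongr
    _ = (N : ℝ) ^ 2 := by rw [hN]; push_cast; ring

/-- `f` is an even function, supported on unimodular pairs and of total sum zero, that is an
eigenfunction of `lineSum` with eigenvalue `μ`. -/
structure IsCuspidalEigenfunction (f : ZMod N × ZMod N → ℝ) (μ : ℝ) : Prop where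
  ne_zero : f ≠ 0
  even : ∀ v, f (-v) = f v
  support : ∀ v, ¬ Completable v → f v = 0
  sum_eq_zero : ∑ v, f v = 0
  eigen : ∀ v, lineSum f v = μ * f v

theorem IsCuspidalEigenfunction.pushSum [NeZero M] {f : ZMod N × ZMod N → ℝ} {μ : ℝ}
    (h : IsCuspidalEigenfunction f μ) (hp : p.Prime) (hN : N = p * M) (hd : M ∣ N)
    (hne : pushSum hd f ≠ 0) : IsCuspidalEigenfunction (pushSum hd f) (μ / p) where
  ne_zero := hne
  even := pushSum_neg hd h.even
  support := fun _ hx => pushSum_eq_zero hd h.support hx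
  sum_eq_zero := (sum_pushSum hd f).trans h.sum_eq_zero
  eigen := by
    intro x
    have hp0 : (p : ℝ) ≠ 0 := Nat.cast_ne_zero.2 hp.ne_zero
    have h1 := lineSum_pushSum hN hd h.even h.support x
    have h2 : _root_.pushSum hd (lineSum f) x = μ * _root_.pushSum hd f x := by
      simp only [_root_.pushSum, Finset.mul_sum]
      refine Finset.sum_congr rfl fun w _ => ?_
      rw [h.eigen]
      simp
    rw [h2] at h1
    field_simp
    linarith

/-- The possible positions of an eigenvalue of a cuspidal eigenfunction. -/
def EigenvalueBound (N : ℕ) (μ : ℝ) : Prop :=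
  (∃ p : ℕ, p.Prime ∧ 5 ≤ p ∧ p ∣ N ∧ |μ| ≤ N / √p) ∨ (3 ∣ N ∧ μ = -(N / 3)) ∨
    (9 ∣ N ∧ |μ| ≤ N / 3)

omit [NeZero N] in
theorem EigenvalueBound.of_div (hp : p.Prime) (hN : N = p * M) {μ : ℝ}
    (h : EigenvalueBound M (μ / p)) : EigenvalueBound N μ := by
  have hp0 : (0 : ℝ) < p := Nat.cast_pos.2 hp.pos
  have hMN : M ∣ N := Dvd.intro_left _ hN.symm
  have hNR : (N : ℝ) = p * M := by rw [hN, Nat.cast_mul]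
  rcases h with ⟨q, hq, h5, hd, h⟩ | ⟨hd, h⟩ | ⟨hd, h⟩
  · refine Or.inl ⟨q, hq, h5, hd.trans hMN, ?_⟩
    rw [abs_div, Nat.abs_cast, div_le_iff₀ hp0] at h
    rw [hNR]
    exact h.trans_eq (by ring)
  · refine Or.inr (Or.inl ⟨hd.trans hMN, ?_⟩)
    rw [div_eq_iff hp0.ne'] at h
    rw [h, hNR]
    ring
  · refine Or.inr (Or.inr ⟨hd.trans hMN, ?_⟩)
    rw [abs_div, Nat.abs_cast, div_le_iff₀ hp0] at h
    rw [hNR]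
    exact h.trans_eq (by ring)

theorem eigenvalueBound_three {N : ℕ} [NeZero N] (hN : N = 3) {f : ZMod N × ZMod N → ℝ} {μ : ℝ}
    (h : IsCuspidalEigenfunction f μ) : EigenvalueBound N μ := by
  subst hN
  obtain ⟨v, hv⟩ := Function.ne_iff.1 h.ne_zero
  have hv' : f v ≠ 0 := hv
  have hc : Completable v := by
    by_contra hc
    exact hv' (h.support v hc)
  have h1 := lineSum_three h.even h.support h.sum_eq_zero hc
  rw [h.eigen] at h1
  refine Or.inr (Or.inl ⟨dvd_rfl, mul_right_cancel₀ hv' (h1.trans ?_)⟩)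
  push_cast
  ring

theorem not_isCuspidalEigenfunction_one {N : ℕ} [NeZero N] (hN : N = 1)
    {f : ZMod N × ZMod N → ℝ} {μ : ℝ} : ¬ IsCuspidalEigenfunction f μ := by
  subst hN
  intro h
  apply h.ne_zero
  ext v
  have h1 := h.sum_eq_zero
  rw [Fintype.sum_subsingleton _ v] at h1
  exact h1

theorem eigenvalueBound_three_pow {N k : ℕ} [NeZero N] (hN : N = 3 ^ (k + 1)) (hk : 1 ≤ k)
    {f : ZMod N × ZMod N → ℝ} {μ : ℝ} (h : IsCuspidalEigenfunction f μ)
    (hf : ∀ w, ∑ l, f (w + ((3 ^ k : ℕ) : ZMod N) • l) = 0) : EigenvalueBound N μ := by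
  have h1 := eigenvalue_sq_le_prime_pow Nat.prime_three hN hk h.even h.ne_zero h.support hf h.eigen
  refine Or.inr (Or.inr ⟨?_, ?_⟩)
  · rw [hN]
    exact pow_dvd_pow 3 (by omega : 2 ≤ k + 1)
  · have h2 : (N : ℝ) = 3 ^ (k + 1) := by rw [hN]; push_cast; rfl
    -- The chain is `μ² ≤ 3 ^ (k + 1) ≤ 3 ^ (2 * k) = (N / 3)²`, using `k ≥ 1`.
    refine abs_le_of_sq_le_sq (h1.trans ?_) (by positivity)
    rw [h2, pow_succ (3 : ℝ) k, mul_div_cancel_right₀ _ (by norm_num), ← pow_mul, ← pow_succ]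
    exact pow_le_pow_right₀ (by norm_num) (by omega)

theorem IsCuspidalEigenfunction.eigenvalueBound : ∀ (N : ℕ) [NeZero N], Odd N →
    ∀ {f : ZMod N × ZMod N → ℝ} {μ : ℝ}, IsCuspidalEigenfunction f μ → EigenvalueBound N μ := by
  intro N
  induction N using Nat.strong_induction_on with
  | _ N ih =>
  intro _ hodd f μ h
  have descend : ∀ p M : ℕ, p.Prime → N = p * M → EigenvalueBound N μ ∨
      ∀ w, ∑ l, f (w + (M : ZMod N) • l) = 0 := by
    intro p M hp hN
    have hM : NeZero M := ⟨fun h0 => NeZero.ne N (by rw [hN, h0, mul_zero])⟩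
    have hd : M ∣ N := Dvd.intro_left _ hN.symm
    by_cases hne : _root_.pushSum hd f = 0
    · right
      intro w
      rw [sum_add_natCast_smul hp hN hd, hne, Pi.zero_apply, mul_zero]
    · left
      have hlt : M < N := by
        rw [hN]
        exact lt_mul_of_one_lt_left (NeZero.pos M) hp.one_lt
      exact (ih M hlt (Odd.of_dvd_nat hodd hd) (h.pushSum hp hN hd hne)).of_div hp hN
  -- Primes at least 5 are stripped first: at 3 the norm bound only gives `N / √3`, which exceeds `N
  -- / 3`.
  by_cases hbig : ∃ p : ℕ, p.Prime ∧ 5 ≤ p ∧ p ∣ N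
  · obtain ⟨p, hp, h5, M, hN⟩ := hbig
    rcases descend p M hp hN with hb | hz
    · exact hb
    · exact Or.inl ⟨p, hp, h5, Dvd.intro _ hN.symm, abs_eigenvalue_le hp hN h.ne_zero hz h.eigen⟩
  · have h3 : ∀ {d : ℕ}, d.Prime → d ∣ N → d = 3 := by
      intro d hd hdN
      have h2 := hd.two_le
      have hlt : d < 5 := by
        by_contra! h5
        exact hbig ⟨d, hd, h5, hdN⟩
      have hdo := Odd.of_dvd_nat hodd hdN
      rcases hdo with ⟨m, hm⟩
      omega
    obtain ⟨n, hn⟩ : ∃ n, N = 3 ^ n := ⟨_, Nat.eq_prime_pow_of_unique_prime_dvd (NeZero.ne N) h3⟩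
    match n, hn with
    | 0, hn => exact absurd h (not_isCuspidalEigenfunction_one (by simpa using hn))
    | 1, hn => exact eigenvalueBound_three (by simpa using hn) h
    | k + 2, hn =>
      rcases descend 3 (3 ^ (k + 1)) Nat.prime_three (by rw [hn, pow_succ']) with hb | hz
      · exact hb
      · exact eigenvalueBound_three_pow hn (by omega) h hz

end Spectrum

/-! ### Explicit eigenfunctions of eigenvalue `±√d`. -/

section Existence

variable {N : ℕ} [NeZero N]

/-- The even test function `δ₁ + δ₋₁ - δ₂ - δ₋₂`. -/
def testFun (b : ZMod N) : ℤ :=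
  (if b = 1 then 1 else 0) + (if b = -1 then 1 else 0) - (if b = 2 then 1 else 0) -
    if b = -2 then 1 else 0

omit [NeZero N] in
theorem testFun_neg (b : ZMod N) : testFun (-b) = testFun b := by
  simp only [testFun, neg_eq_iff_eq_neg, neg_neg]
  ring

omit [NeZero N] in
theorem testFun_eq_zero (hodd : Odd N) {b : ZMod N} (hb : ¬ IsUnit b) : testFun b = 0 := by
  have h2 : IsUnit (2 : ZMod N) := by
    have := (ZMod.isUnit_iff_coprime 2 N).2 (Nat.coprime_two_left.2 hodd)
    simpa using this
  have e1 : b ≠ 1 := fun h => hb (h ▸ isUnit_one)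
  have e2 : b ≠ -1 := fun h => hb (h ▸ isUnit_one.neg)
  have e3 : b ≠ 2 := fun h => hb (h ▸ h2)
  have e4 : b ≠ -2 := fun h => hb (h ▸ h2.neg)
  simp [testFun, e1, e2, e3, e4]

omit [NeZero N] in
theorem testFun_one (h5 : 5 ≤ N) : testFun (1 : ZMod N) = 1 := by
  have hk : ∀ k : ℕ, 0 < k → k < 5 → (k : ZMod N) ≠ 0 := fun k h0 hk h => by
    have := Nat.le_of_dvd h0 ((ZMod.natCast_eq_zero_iff k N).1 h)
    omega
  have e2 : (1 : ZMod N) ≠ -1 := fun h => hk 2 (by norm_num) (by norm_num) (by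
    push_cast; linear_combination h)
  have e3 : (1 : ZMod N) ≠ 2 := fun h => hk 1 (by norm_num) (by norm_num) (by
    push_cast; linear_combination -h)
  have e4 : (1 : ZMod N) ≠ -2 := fun h => hk 3 (by norm_num) (by norm_num) (by
    push_cast; linear_combination h)
  simp [testFun, e2, e3, e4]

theorem sum_testFun : ∑ b : ZMod N, testFun b = 0 := by
  simp [testFun, Finset.sum_add_distrib, Finset.sum_sub_distrib]

/-- The test function sums to zero over every nontrivial arithmetic progression. -/
def TestFunBalanced (N : ℕ) [NeZero N] : Prop :=
  ∀ b r : ZMod N, r ≠ 0 → ∑ t : ZMod N, testFun (b + t * r) = 0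

theorem testFunBalanced_prime (hN : N.Prime) : TestFunBalanced N := by
  have : Fact N.Prime := ⟨hN⟩
  intro b r hr
  rw [← sum_testFun (N := N)]
  exact Equiv.sum_comp ((Equiv.mulRight₀ r hr).trans (Equiv.addLeft b)) testFun

/-- The nontrivial point is steps divisible by 3: the class of 1 modulo 3 contains 1 and -2, the
class of 2 contains 2 and -1, so the signs cancel in each. -/
theorem testFunBalanced_nine : TestFunBalanced 9 := by
  unfold TestFunBalanced
  decide +kernel

/-- An eigenfunction of `lineSum` with eigenvalue `c`, where `c ^ 2 = N`. -/
noncomputable def testEigenfunction (c : ℝ) (v : ZMod N × ZMod N) : ℝ :=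
  c * (if v.2 = 0 then (testFun (Ring.inverse v.1) : ℝ) else 0) + testFun v.2

theorem ringInverse_neg {R : Type*} [Ring R] (a : R) : Ring.inverse (-a) = -Ring.inverse a := by
  by_cases h : IsUnit a
  · obtain ⟨u, rfl⟩ := h
    rw [← Units.val_neg, Ring.inverse_unit, Ring.inverse_unit, inv_neg, Units.val_neg]
  · rw [Ring.inverse_non_unit _ h, Ring.inverse_non_unit _ (mt (IsUnit.neg_iff a).1 h), neg_zero]

omit [NeZero N] in
theorem testEigenfunction_neg (c : ℝ) (v : ZMod N × ZMod N) :
    testEigenfunction c (-v) = testEigenfunction c v := by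
  simp [testEigenfunction, ringInverse_neg, testFun_neg]

omit [NeZero N] in
theorem testEigenfunction_one_zero (h5 : 5 ≤ N) (hodd : Odd N) (c : ℝ) :
    testEigenfunction c ((1, 0) : ZMod N × ZMod N) = c := by
  have : Nontrivial (ZMod N) := ZMod.nontrivial_iff.2 (by omega)
  simp [testEigenfunction, testFun_one h5, testFun_eq_zero hodd not_isUnit_zero]

/-- Write the function as `c A + B`, with `A` living on `v.2 = 0` and `B v = testFun v.2`. Then
`lineSum` sends `A` to `B`, and `B` to `N A`: along a line `w.2` moves in steps of `v.2`, so balance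
kills the sum unless `v.2 = 0`, when `w.2` is constantly the inverse of `v.1`. -/
theorem lineSum_testEigenfunction (hodd : Odd N) (hbal : TestFunBalanced N) {c : ℝ}
    (hc : c ^ 2 = N) {v : ZMod N × ZMod N} (hv : Completable v) :
    lineSum (testEigenfunction c) v = c * testEigenfunction c v := by
  have h1 : ∀ v : ZMod N × ZMod N, lineSum (testEigenfunction c) v =
      c * (∑ a : ZMod N, if -v.2 * a = 1 then (testFun (Ring.inverse a) : ℝ) else 0) +
      lineSum (fun w => (testFun w.2 : ℝ)) v := by
    intro v
    have h2 : ∀ a : ZMod N, (if -v.2 * a = 1 then (testFun (Ring.inverse a) : ℝ) else 0) =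
        ∑ b : ZMod N, if symp v (a, b) = 1 then
          (if b = 0 then (testFun (Ring.inverse a) : ℝ) else 0) else 0 := by
      intro a
      rw [Finset.sum_eq_single 0]
      · simp [symp]
      · intro b _ hb
        simp [hb]
      · simp
    simp only [h2]
    rw [← Fintype.sum_prod_type', Finset.mul_sum, lineSum, lineSum, ← Finset.sum_add_distrib]
    refine Finset.sum_congr rfl fun w _ => ?_
    split_ifs <;> simp_all [testEigenfunction]
  have h3 : (∑ a : ZMod N, if -v.2 * a = 1 then (testFun (Ring.inverse a) : ℝ) else 0) =
      testFun v.2 := by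
    by_cases hu : IsUnit v.2
    · obtain ⟨u, hu⟩ := hu
      rw [Finset.sum_eq_single ((-u⁻¹ : (ZMod N)ˣ) : ZMod N)]
      · rw [Ring.inverse_unit, inv_neg, inv_inv, ← hu]
        simp [testFun_neg]
      · intro a _ ha
        rw [if_neg]
        intro h
        apply ha
        rw [← hu, neg_mul, neg_eq_iff_eq_neg] at h
        rw [Units.val_neg, ← mul_neg_one, ← h, Units.inv_mul_cancel_left]
      · simp
    · rw [testFun_eq_zero hodd hu, Int.cast_zero]
      refine Finset.sum_eq_zero fun a _ => if_neg fun h => hu ?_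
      exact IsUnit.of_mul_eq_one (-a) (by linear_combination h)
  obtain ⟨w, h⟩ := hv
  have h4 : lineSum (fun w => (testFun w.2 : ℝ)) v =
      N * if v.2 = 0 then (testFun (Ring.inverse v.1) : ℝ) else 0 := by
    rw [lineSum_eq h]
    simp only [Prod.snd_add, Prod.smul_snd, smul_eq_mul]
    split_ifs with h0
    · have hw : v.1 * w.2 = 1 := by
        rw [symp, h0] at h
        linear_combination h
      have : Ring.inverse v.1 = w.2 := by
        rw [← Ring.inverse_mul_cancel_left v.1 w.2 (IsUnit.of_mul_eq_one _ hw), hw, mul_one]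
      simp [h0, this, ZMod.card]
    · rw [mul_zero]
      exact_mod_cast hbal w.2 v.2 h0
  rw [h1, h3, h4, ← hc, testEigenfunction]
  ring

end Existence


/-! ### Translation between the graph and functions on pairs. -/

section Graph

variable {R : Type*} [CommRing R]

/-- The vertex of the Platonic graph represented by a unimodular pair. -/
def platonicMk (v : R × R) (hv : Completable v) : PlatonicVertex R :=
  Quotient.mk (unimodularPairSignSetoid R) ⟨v, (completable_iff_span v).1 hv⟩

theorem platonicMk_eq_iff {v w : R × R} (hv : Completable v) (hw : Completable w) :
    platonicMk v hv = platonicMk w hw ↔ w = v ∨ w = -v :=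
  Quotient.eq

theorem exists_platonicMk (x : PlatonicVertex R) : ∃ v hv, platonicMk v hv = x := by
  induction x using Quotient.inductionOn with
  | h v => exact ⟨v.1, (completable_iff_span v.1).2 v.2, rfl⟩

theorem platonicMk_neg {v : R × R} (hv : Completable v) :
    platonicMk (-v) hv.neg = platonicMk v hv :=
  (platonicMk_eq_iff _ _).2 (Or.inr (neg_neg v).symm)

theorem adj_platonicMk_iff [Nontrivial R] {v : R × R} (hv : Completable v)
    (y : PlatonicVertex R) :
    (platonicGraph R).Adj (platonicMk v hv) y ↔
      ∃ w hw, symp v w = 1 ∧ platonicMk w hw = y := by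
  constructor
  · rintro ⟨-, v', w', hv', rfl, h⟩
    have hw' : Completable w'.1 := (completable_iff_span _).2 w'.2
    have h' : symp v'.1 w'.1 = 1 ∨ symp v'.1 w'.1 = -1 := h
    have hmk : platonicMk w'.1 hw' = Quotient.mk (unimodularPairSignSetoid R) w' := rfl
    have hvv : v = v'.1 ∨ v = -v'.1 := Quotient.exact hv'
    have hsign : symp v w'.1 = 1 ∨ symp v w'.1 = -1 := by
      rcases hvv with h1 | h1
      · rwa [h1]
      · rw [h1, symp_neg_left, neg_inj, neg_eq_iff_eq_neg]
        exact h'.symm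
    rcases hsign with h1 | h1
    · exact ⟨w'.1, hw', h1, hmk⟩
    · exact ⟨-w'.1, hw'.neg, by rw [symp_neg, h1, neg_neg], (platonicMk_neg hw').trans hmk⟩
  · rintro ⟨w, hw, h, rfl⟩
    refine ⟨?_, _, _, rfl, rfl, Or.inl h⟩
    intro he
    rcases (platonicMk_eq_iff hv hw).1 he with h1 | h1
    · rw [h1, symp_self] at h
      exact zero_ne_one h
    · rw [h1, symp_neg, symp_self, neg_zero] at h
      exact zero_ne_one h

open Classical in
/-- The function on pairs induced by a function on vertices, extended by zero. -/
noncomputable def pairLift (h : PlatonicVertex R → ℝ) (v : R × R) : ℝ :=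
  if hv : Completable v then h (platonicMk v hv) else 0

theorem pairLift_of_completable (h : PlatonicVertex R → ℝ) {v : R × R} (hv : Completable v) :
    pairLift h v = h (platonicMk v hv) := dif_pos hv

theorem pairLift_of_not_completable (h : PlatonicVertex R → ℝ) {v : R × R}
    (hv : ¬ Completable v) : pairLift h v = 0 := dif_neg hv

theorem pairLift_neg (h : PlatonicVertex R → ℝ) (v : R × R) :
    pairLift h (-v) = pairLift h v := by
  by_cases hv : Completable v
  · rw [pairLift_of_completable h hv, pairLift_of_completable h hv.neg, platonicMk_neg hv]
  · rw [pairLift_of_not_completable h hv, pairLift_of_not_completable h]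
    exact fun h' => hv (neg_neg v ▸ h'.neg)

theorem pairLift_eq_zero_iff {h : PlatonicVertex R → ℝ} : pairLift h = 0 ↔ h = 0 := by
  constructor
  · intro h0
    ext x
    obtain ⟨v, hv, rfl⟩ := exists_platonicMk x
    rw [← pairLift_of_completable h hv, h0]
    rfl
  · rintro rfl
    ext v
    by_cases hv : Completable v
    · exact pairLift_of_completable _ hv
    · exact pairLift_of_not_completable _ hv

theorem exists_pairLift_eq {f : R × R → ℝ} (heven : ∀ v, f (-v) = f v)
    (hf0 : ∀ v, ¬ Completable v → f v = 0) : ∃ h, pairLift h = f := by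
  refine ⟨Quotient.lift (fun v : UnimodularPair R => f v.1) ?_, ?_⟩
  · rintro v w (h | h)
    · rw [h]
    · rw [h, heven]
  · ext v
    by_cases hv : Completable v
    · exact pairLift_of_completable _ hv
    · exact (pairLift_of_not_completable _ hv).trans (hf0 v hv).symm

variable [Fintype R] [DecidableEq R]

/-- Each neighbour has exactly one representative with `symp v w = 1`; uniqueness is where `1 ≠ -1`
is needed. -/
theorem sum_neighborFinset (h1 : (1 : R) ≠ -1) (h : PlatonicVertex R → ℝ) {v : R × R}
    (hv : Completable v) :
    ∑ y ∈ (platonicGraph R).neighborFinset (platonicMk v hv), h y = lineSum (pairLift h) v := by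
  have : Nontrivial R := ⟨1, -1, h1⟩
  rw [lineSum, ← Finset.sum_filter]
  symm
  have hc : ∀ w ∈ Finset.univ.filter fun w => symp v w = 1, Completable w := fun w hw =>
    completable_of_symp_right (Finset.mem_filter.1 hw).2
  refine Finset.sum_bij (fun w hw => platonicMk w (hc w hw)) ?_ ?_ ?_ ?_
  · intro w hw
    rw [SimpleGraph.mem_neighborFinset, adj_platonicMk_iff]
    exact ⟨w, _, (Finset.mem_filter.1 hw).2, rfl⟩
  · intro w hw w' hw' he
    rcases (platonicMk_eq_iff _ _).1 he with h2 | h2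
    · exact h2.symm
    · have e1 := (Finset.mem_filter.1 hw).2
      have e2 := (Finset.mem_filter.1 hw').2
      rw [h2, symp_neg, e1] at e2
      exact absurd e2.symm h1
  · intro y hy
    rw [SimpleGraph.mem_neighborFinset, adj_platonicMk_iff] at hy
    obtain ⟨w, hw, h2, rfl⟩ := hy
    exact ⟨w, by simpa using h2, rfl⟩
  · intro w hw
    exact pairLift_of_completable h (hc w hw)

theorem platonicGraph_isRegular (h1 : (1 : R) ≠ -1) :
    (platonicGraph R).IsRegularOfDegree (Fintype.card R) := by
  intro x
  obtain ⟨v, hv, rfl⟩ := exists_platonicMk x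
  have h2 := sum_neighborFinset h1 (fun _ => 1) hv
  obtain ⟨w, hw⟩ := hv
  rw [lineSum_eq hw] at h2
  have h3 : ∀ t : R, pairLift (fun _ : PlatonicVertex R => (1 : ℝ)) (w + t • v) = 1 := fun t =>
    pairLift_of_completable _ (completable_of_symp_right (v := v)
      (by rw [symp_add_smul, hw, symp_self, mul_zero, add_zero]))
  simp only [h3, Finset.sum_const, nsmul_eq_mul, mul_one, SimpleGraph.card_neighborFinset_eq_degree,
    Finset.card_univ] at h2
  exact_mod_cast h2

theorem adjMatrix_mulVecLin_eq_iff (h1 : (1 : R) ≠ -1) (h : PlatonicVertex R → ℝ) (μ : ℝ) :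
    ((platonicGraph R).adjMatrix ℝ).mulVecLin h = μ • h ↔
      ∀ v, lineSum (pairLift h) v = μ * pairLift h v := by
  constructor
  · intro he v
    by_cases hv : Completable v
    · rw [← sum_neighborFinset h1 h hv, pairLift_of_completable h hv,
        ← SimpleGraph.adjMatrix_mulVec_apply]
      exact congrFun he _
    · rw [lineSum_of_not_completable hv, pairLift_of_not_completable h hv, mul_zero]
  · intro he
    ext x
    obtain ⟨v, hv, rfl⟩ := exists_platonicMk x
    rw [Matrix.mulVecLin_apply, SimpleGraph.adjMatrix_mulVec_apply, sum_neighborFinset h1 h hv,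
      he v, pairLift_of_completable h hv]
    rfl

/-- An even eigenfunction of `lineSum` gives an adjacency eigenvalue. -/
theorem hasEigenvalue_platonicGraph (h1 : (1 : R) ≠ -1) {f : R × R → ℝ} {μ : ℝ} (hne : f ≠ 0)
    (heven : ∀ v, f (-v) = f v) (hf0 : ∀ v, ¬ Completable v → f v = 0)
    (hμ : ∀ v, lineSum f v = μ * f v) :
    Module.End.HasEigenvalue ((platonicGraph R).adjMatrix ℝ).mulVecLin μ := by
  obtain ⟨h, rfl⟩ := exists_pairLift_eq heven hf0
  refine Module.End.hasEigenvalue_of_hasEigenvector (x := h) ⟨?_, ?_⟩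
  · exact Module.End.mem_eigenspace_iff.2 ((adjMatrix_mulVecLin_eq_iff h1 h μ).2 hμ)
  · exact mt pairLift_eq_zero_iff.2 hne

end Graph

/-! ### Nontrivial eigenvalues and the extremal values. -/

section Main

variable {N : ℕ} [NeZero N]

/-- The total sum of the lift of a vertex function to pairs, as a linear functional. -/
noncomputable def pairTotal (N : ℕ) [NeZero N] : (PlatonicVertex (ZMod N) → ℝ) →ₗ[ℝ] ℝ where
  toFun h := ∑ v, pairLift h v
  map_add' g h := by
    rw [← Finset.sum_add_distrib]
    refine Finset.sum_congr rfl fun v _ => ?_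
    by_cases hv : Completable v
    · simp [pairLift_of_completable _ hv]
    · simp [pairLift_of_not_completable _ hv]
  map_smul' c h := by
    rw [RingHom.id_apply, smul_eq_mul, Finset.mul_sum]
    refine Finset.sum_congr rfl fun v _ => ?_
    by_cases hv : Completable v
    · simp [pairLift_of_completable _ hv]
    · simp [pairLift_of_not_completable _ hv]

/-- If `μ ≠ N`, comparing total sums in the eigenvalue equation forces the total to vanish. If `μ =
N`, the eigenspace has dimension at least two and so meets the kernel of the total functional. -/
theorem exists_isCuspidalEigenfunction (h1 : (1 : ZMod N) ≠ -1) {μ : ℝ}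
    (hμ : (platonicGraph (ZMod N)).IsNontrivialEigenvalue N μ) :
    ∃ f : ZMod N × ZMod N → ℝ, IsCuspidalEigenfunction f μ := by
  obtain ⟨hev, hmult⟩ := hμ
  have key : ∃ h : PlatonicVertex (ZMod N) → ℝ, h ≠ 0 ∧
      h ∈ Module.End.eigenspace ((platonicGraph (ZMod N)).adjMatrix ℝ).mulVecLin μ ∧
      pairTotal N h = 0 := by
    by_cases hN : μ = N
    · have hlt := hmult hN
      set E := Module.End.eigenspace ((platonicGraph (ZMod N)).adjMatrix ℝ).mulVecLin μ
      have hker := LinearMap.ker_ne_bot_of_finrank_lt (f := (pairTotal N).domRestrict E)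
        (by rwa [Module.finrank_self])
      obtain ⟨h, hh, hne⟩ := Submodule.exists_mem_ne_zero_of_ne_bot hker
      exact ⟨h, fun h0 => hne (Subtype.ext h0), h.2, hh⟩
    · obtain ⟨h, hmem, hne⟩ := hev.exists_hasEigenvector
      refine ⟨h, hne, hmem, ?_⟩
      have h2 := (adjMatrix_mulVecLin_eq_iff h1 h μ).1 (Module.End.mem_eigenspace_iff.1 hmem)
      have h3 := sum_lineSum (f := pairLift h) fun v hv => pairLift_of_not_completable h hv
      simp only [h2, ← Finset.mul_sum, ZMod.card] at h3
      have h4 : (μ - N) * ∑ v, pairLift h v = 0 := by linear_combination h3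
      exact (mul_eq_zero.1 h4).resolve_left (sub_ne_zero.2 hN)
  obtain ⟨h, hne, hmem, hsum⟩ := key
  exact ⟨pairLift h, mt pairLift_eq_zero_iff.1 hne, pairLift_neg h,
    fun v hv => pairLift_of_not_completable h hv, hsum,
    (adjMatrix_mulVecLin_eq_iff h1 h μ).1 (Module.End.mem_eigenspace_iff.1 hmem)⟩

/-- Eigenfunctions of `lineSum` modulo a divisor give adjacency eigenvalues of the Platonic
graph. -/
theorem hasEigenvalue_of_divisor (h1 : (1 : ZMod N) ≠ -1) {d k : ℕ} [NeZero d] (hN : N = k * d)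
    {f : ZMod d × ZMod d → ℝ} (hne : f (1, 0) ≠ 0) (heven : ∀ v, f (-v) = f v) {c : ℝ}
    (hc : ∀ v, Completable v → lineSum f v = c * f v) :
    Module.End.HasEigenvalue ((platonicGraph (ZMod N)).adjMatrix ℝ).mulVecLin (k * c) := by
  classical
  have hd : d ∣ N := Dvd.intro_left _ hN.symm
  -- The cut-off is needed because a non-unimodular pair modulo `N` may become unimodular modulo
  -- `d`.
  set F : ZMod N × ZMod N → ℝ := fun v => if Completable v then f (reducePair hd v) else 0 with hF
  have hpos : ∀ {v}, Completable v → F v = f (reducePair hd v) := fun hv => if_pos hv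
  have hneg : ∀ v, ¬ Completable v → F v = 0 := fun v hv => if_neg hv
  refine hasEigenvalue_platonicGraph h1 (f := F) ?_ ?_ hneg ?_
  · intro h0
    have hc1 : Completable ((1, 0) : ZMod N × ZMod N) := ⟨(0, 1), by simp [symp]⟩
    have h2 := hpos hc1
    rw [h0, Pi.zero_apply] at h2
    apply hne
    rw [h2, reducePair, map_one, map_zero]
  · intro v
    by_cases hv : Completable v
    · rw [hpos hv, hpos hv.neg, reducePair_neg, heven]
    · rw [hneg v hv, hneg]
      exact fun h' => hv (neg_neg v ▸ h'.neg)
  · intro v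
    by_cases hv : Completable v
    · rw [hpos hv, mul_assoc, ← hc _ (hv.reducePair hd), ← lineSum_comp_reducePair hN hd f hv]
      refine Finset.sum_congr rfl fun w _ => ?_
      split_ifs with hw
      · exact hpos (completable_of_symp_right hw)
      · rfl
    · rw [lineSum_of_not_completable hv, hneg v hv, mul_zero]

theorem isNontrivialEigenvalue_of_balanced (h1 : (1 : ZMod N) ≠ -1) {d k : ℕ} [NeZero d]
    (hN : N = k * d) (hodd : Odd d) (h5 : 5 ≤ d) (hbal : TestFunBalanced d) {c : ℝ}
    (hc : c ^ 2 = d) : (platonicGraph (ZMod N)).IsNontrivialEigenvalue N (k * c) := by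
  have hd : (5 : ℝ) ≤ d := by exact_mod_cast h5
  have hc0 : c ≠ 0 := by
    rintro rfl
    norm_num at hc
    linarith
  refine ⟨hasEigenvalue_of_divisor h1 hN (f := testEigenfunction c) ?_ (testEigenfunction_neg c)
    fun v hv => lineSum_testEigenfunction hodd hbal hc hv, fun he => ?_⟩
  · rwa [testEigenfunction_one_zero h5 hodd]
  -- Equality with `N` would mean `c = d`, contradicting `c ^ 2 = d` and `d ≥ 5`.
  · exfalso
    have hk : (k : ℝ) ≠ 0 := by
      intro h
      apply NeZero.ne N
      rw [hN, Nat.cast_eq_zero.1 h, zero_mul]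
    rw [hN, Nat.cast_mul] at he
    have := mul_left_cancel₀ hk he
    rw [this] at hc
    nlinarith

theorem isNontrivialEigenvalue_sqrt (h1 : (1 : ZMod N) ≠ -1) (hodd : Odd N) {p : ℕ}
    (hp : p.Prime) (h5 : 5 ≤ p) (hd : p ∣ N) :
    (platonicGraph (ZMod N)).IsNontrivialEigenvalue N (N / √p) ∧
      (platonicGraph (ZMod N)).IsNontrivialEigenvalue N (-(N / √p)) := by
  have : NeZero p := ⟨hp.ne_zero⟩
  obtain ⟨k, hk⟩ := hd
  have hN : N = k * p := hk.trans (mul_comm _ _)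
  have hpo : Odd p := Odd.of_dvd_nat hodd (Dvd.intro _ hk.symm)
  have hp0 : (0 : ℝ) ≤ p := Nat.cast_nonneg p
  have hbal := testFunBalanced_prime hp
  have he : (N : ℝ) / √p = k * √p := by
    rw [hN, Nat.cast_mul, mul_div_assoc, Real.div_sqrt]
  constructor
  · rw [he]
    exact isNontrivialEigenvalue_of_balanced h1 hN hpo h5 hbal (Real.sq_sqrt hp0)
  · rw [he, ← mul_neg]
    exact isNontrivialEigenvalue_of_balanced h1 hN hpo h5 hbal
      (by rw [neg_sq, Real.sq_sqrt hp0])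

theorem isNontrivialEigenvalue_nine (h1 : (1 : ZMod N) ≠ -1) (hd : 9 ∣ N) :
    (platonicGraph (ZMod N)).IsNontrivialEigenvalue N (N / 3) ∧
      (platonicGraph (ZMod N)).IsNontrivialEigenvalue N (-(N / 3)) := by
  obtain ⟨k, hk⟩ := hd
  have hN : N = k * 9 := hk.trans (mul_comm _ _)
  have he : (N : ℝ) / 3 = k * 3 := by
    rw [hN]
    push_cast
    ring
  have h9 : Odd 9 := by decide
  constructor
  · rw [he]
    exact isNontrivialEigenvalue_of_balanced h1 hN h9 (by norm_num) testFunBalanced_nine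
      (by norm_num)
  · rw [he, ← mul_neg]
    exact isNontrivialEigenvalue_of_balanced h1 hN h9 (by norm_num) testFunBalanced_nine
      (by norm_num)

theorem isNontrivialEigenvalue_three (h1 : (1 : ZMod N) ≠ -1) (hd : 3 ∣ N) :
    (platonicGraph (ZMod N)).IsNontrivialEigenvalue N (-(N / 3)) := by
  classical
  obtain ⟨k, hk⟩ := hd
  have hN : N = k * 3 := hk.trans (mul_comm _ _)
  have hNpos : (0 : ℝ) < N := Nat.cast_pos.2 (NeZero.pos N)
  have he : -((N : ℝ) / 3) = k * (-1) := by
    rw [hN]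
    push_cast
    ring
  refine ⟨?_, fun h => ?_⟩
  -- The difference of two vertex indicators on the complete graph of level 3.
  · set g : ZMod 3 × ZMod 3 → ℝ := fun v => (if v = (1, 0) then 1 else 0) +
      (if v = -(1, 0) then 1 else 0) - (if v = (0, 1) then 1 else 0) -
      (if v = -(0, 1) then 1 else 0) with hg
    have heven : ∀ v, g (-v) = g v := fun v => by
      simp only [hg, neg_eq_iff_eq_neg, neg_neg]
      ring
    have hsum : ∑ v, g v = 0 := by
      simp [hg, Finset.sum_add_distrib, Finset.sum_sub_distrib]
    have c1 : Completable ((1, 0) : ZMod 3 × ZMod 3) := ⟨(0, 1), by simp [symp]⟩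
    have c2 : Completable ((0, 1) : ZMod 3 × ZMod 3) := ⟨(-1, 0), by simp [symp]⟩
    have hg0 : ∀ v, ¬ Completable v → g v = 0 := by
      intro v hv
      have e1 : v ≠ (1, 0) := fun h => hv (h ▸ c1)
      have e2 : v ≠ -(1, 0) := fun h => hv (h ▸ c1.neg)
      have e3 : v ≠ (0, 1) := fun h => hv (h ▸ c2)
      have e4 : v ≠ -(0, 1) := fun h => hv (h ▸ c2.neg)
      simp only [hg, e1, e2, e3, e4, if_false]
      norm_num
    rw [he]
    refine hasEigenvalue_of_divisor h1 hN (f := g) ?_ heven fun v hv => ?_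
    · have e2 : ((1, 0) : ZMod 3 × ZMod 3) ≠ -(1, 0) := by decide
      have e3 : ((1, 0) : ZMod 3 × ZMod 3) ≠ (0, 1) := by decide
      have e4 : ((1, 0) : ZMod 3 × ZMod 3) ≠ -(0, 1) := by decide
      simp only [hg, e2, e3, e4, if_false, if_true]
      norm_num
    · rw [lineSum_three heven hg0 hsum hv]
      ring
  · linarith

end Main

theorem mainTheorem8 (N ℓ N' p' : ℕ) [NeZero N] (hN : N = 3 ^ ℓ * N') (hodd : Odd N)
    (hN' : 1 < N') (h3 : ¬ 3 ∣ N') (hp' : IsLeast {p : ℕ | p.Prime ∧ p ∣ N'} p') :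
    (platonicGraph (ZMod N)).IsRegularOfDegree N ∧
    (ℓ = 0 →
      IsGreatest {μ : ℝ | (platonicGraph (ZMod N)).IsNontrivialEigenvalue N μ}
        ((N : ℝ) / √(p' : ℝ)) ∧
      IsLeast {μ : ℝ | (platonicGraph (ZMod N)).IsNontrivialEigenvalue N μ}
        (-((N : ℝ) / √(p' : ℝ)))) ∧
    (ℓ = 1 →
      IsGreatest {μ : ℝ | (platonicGraph (ZMod N)).IsNontrivialEigenvalue N μ}
        ((N : ℝ) / √(p' : ℝ)) ∧
      IsLeast {μ : ℝ | (platonicGraph (ZMod N)).IsNontrivialEigenvalue N μ}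
        (-((N : ℝ) / min 3 √(p' : ℝ)))) ∧
    (2 ≤ ℓ →
      IsGreatest {μ : ℝ | (platonicGraph (ZMod N)).IsNontrivialEigenvalue N μ}
        ((N : ℝ) / min 3 √(p' : ℝ)) ∧
      IsLeast {μ : ℝ | (platonicGraph (ZMod N)).IsNontrivialEigenvalue N μ}
        (-((N : ℝ) / min 3 √(p' : ℝ)))) := by
  obtain ⟨⟨hp, hpN'⟩, hmin⟩ := hp'
  have hpN : p' ∣ N := hN ▸ hpN'.mul_left _
  have h5 : 5 ≤ p' := by
    have h2 := hp.two_le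
    have hne3 : p' ≠ 3 := fun h => h3 (h ▸ hpN')
    obtain ⟨m, hm⟩ := Odd.of_dvd_nat hodd hpN
    omega
  have hN5 : 5 ≤ N := h5.trans (Nat.le_of_dvd (NeZero.pos N) hpN)
  have h1 : (1 : ZMod N) ≠ -1 := by
    intro h
    have h2 : ((2 : ℕ) : ZMod N) = 0 := by
      push_cast
      linear_combination h
    have := Nat.le_of_dvd (by norm_num) ((ZMod.natCast_eq_zero_iff 2 N).1 h2)
    omega
  have hNpos : (0 : ℝ) < N := Nat.cast_pos.2 (NeZero.pos N)
  have hs0 : 0 < √(p' : ℝ) := Real.sqrt_pos.2 (Nat.cast_pos.2 hp.pos)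
  have hm0 : 0 < min 3 √(p' : ℝ) := lt_min (by norm_num) hs0
  obtain ⟨hpos, hneg⟩ := isNontrivialEigenvalue_sqrt h1 hodd hp h5 hpN
  have hle : (N : ℝ) / √p' ≤ N / min 3 √(p' : ℝ) := by
    gcongr
    exact min_le_right _ _
  have hle3 : (N : ℝ) / 3 ≤ N / min 3 √(p' : ℝ) := by
    gcongr
    exact min_le_left _ _
  -- Whichever term realises the minimum, the corresponding value has already been exhibited as an
  -- eigenvalue.
  have hmem : (N : ℝ) / min 3 √(p' : ℝ) = N / 3 ∨ (N : ℝ) / min 3 √(p' : ℝ) = N / √p' := by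
    rcases min_choice 3 √(p' : ℝ) with h | h <;> rw [h] <;> simp
  have bound : ∀ μ, (platonicGraph (ZMod N)).IsNontrivialEigenvalue N μ →
      |μ| ≤ N / √p' ∨ (3 ∣ N ∧ μ = -(N / 3)) ∨ (9 ∣ N ∧ |μ| ≤ N / 3) := by
    intro μ hμ
    obtain ⟨f, hf⟩ := exists_isCuspidalEigenfunction h1 hμ
    rcases hf.eigenvalueBound N hodd with ⟨q, hq, hq5, hqN, hb⟩ | hb
    · left
      have hqN' : q ∣ N' := by
        rw [hN] at hqN
        rcases hq.dvd_mul.1 hqN with h | h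
        · have := (Nat.prime_dvd_prime_iff_eq hq Nat.prime_three).1 (hq.dvd_of_dvd_pow h)
          omega
        · exact h
      have hpq : (p' : ℝ) ≤ q := Nat.cast_le.2 (hmin ⟨hq, hqN'⟩)
      exact hb.trans (by gcongr)
    · exact Or.inr hb
  refine ⟨?_, ?_, ?_, ?_⟩
  · simpa only [ZMod.card] using platonicGraph_isRegular h1
  · intro hℓ
    have hNN : N = N' := by rw [hN, hℓ, pow_zero, one_mul]
    have hb : ∀ μ, (platonicGraph (ZMod N)).IsNontrivialEigenvalue N μ → |μ| ≤ N / √p' := by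
      intro μ hμ
      rcases bound μ hμ with h | ⟨h, -⟩ | ⟨h, -⟩
      · exact h
      · exact absurd (hNN ▸ h) h3
      · exact absurd (hNN ▸ (dvd_trans (by norm_num) h : 3 ∣ N)) h3
    exact ⟨⟨hpos, fun μ hμ => (abs_le.1 (hb μ hμ)).2⟩, ⟨hneg, fun μ hμ => (abs_le.1 (hb μ hμ)).1⟩⟩
  · intro hℓ
    have h9 : ¬ 9 ∣ N := by
      intro h
      apply h3
      rw [hN, hℓ, pow_one] at h
      exact Nat.dvd_of_mul_dvd_mul_left (by norm_num : 0 < 3) h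
    have h3N : 3 ∣ N := by
      rw [hN, hℓ, pow_one]
      exact Nat.dvd_mul_right 3 N'
    have hthree := isNontrivialEigenvalue_three h1 h3N
    refine ⟨⟨hpos, fun μ hμ => ?_⟩, ⟨?_, fun μ hμ => ?_⟩⟩
    · rcases bound μ hμ with h | ⟨-, h⟩ | ⟨h, -⟩
      · exact (abs_le.1 h).2
      -- The level 3 eigenvalue is negative, so it cannot compete for the maximum.
      · rw [h]
        have : 0 < (N : ℝ) / √p' := by positivity
        linarith
      · exact absurd h h9
    · rcases hmem with h | h <;> rw [Set.mem_ofPred_eq, h] <;> assumption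
    · rcases bound μ hμ with h | ⟨-, h⟩ | ⟨h, -⟩
      · linarith [(abs_le.1 h).1]
      · linarith
      · exact absurd h h9
  · intro hℓ
    have h9 : 9 ∣ N := by
      rw [hN]
      exact Dvd.dvd.mul_right (pow_dvd_pow 3 hℓ) N'
    obtain ⟨hpos9, hneg9⟩ := isNontrivialEigenvalue_nine h1 h9
    have hb : ∀ μ, (platonicGraph (ZMod N)).IsNontrivialEigenvalue N μ →
        |μ| ≤ N / min 3 √(p' : ℝ) := by
      intro μ hμ
      rcases bound μ hμ with h | ⟨-, h⟩ | ⟨-, h⟩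
      · exact h.trans hle
      · rw [h, abs_neg, abs_of_pos (by positivity)]
        exact hle3
      · exact h.trans hle3
    refine ⟨⟨?_, fun μ hμ => (abs_le.1 (hb μ hμ)).2⟩, ⟨?_, fun μ hμ => (abs_le.1 (hb μ hμ)).1⟩⟩
    · rcases hmem with h | h <;> rw [Set.mem_ofPred_eq, h] <;> assumption
    · rcases hmem with h | h <;> rw [Set.mem_ofPred_eq, h] <;> assumption
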